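/- Let $k$ be an algebraically closed field of characteristic $p\ge 3$ and let $n$ be a number of variables; if $n=1$ assume $p>3$. Let $A(n)=k[T_1,\dots,T_n]/(T_1^p,\dots,T_n^p)$, let $x_i$ be the image of $T_i$, let $W(n)=\mathrm{Der}_k(A(n))$ be the Jacobson–Witt algebra, and let $\partial_i\in W(n)$ be the derivation induced by $\partial/\partial T_i$. For $a\in\{0,\dots,p-1\}^n$ write $x^a=x_1^{a_1}\cdots x_n^{a_n}$ and $|a|=a_1+\dots+a_n$. Put $W(n)_{[s]}=\mathrm{span}_k\{x^a\partial_j : |a|=s+1\}$ and $W(n)_i=\sum_{j\ge i}W(n)_{[j]}$. Let $G=\mathrm{Aut}(W(n))$ be the group of Lie algebra automorphisms, and let $$\Phi:\mathrm{Aut}_k(A(n))\to G,\qquad \Phi(\varphi)(D)=\varphi\circ D\circ\varphi^{-1},$$ be the homomorphism through which $G$ is identified with $\mathrm{Aut}_k(A(n))$. Define: * $\mathfrak b_n=W(n)_{[-1]}+\mathrm{span}_k\{x_i\partial_q : i\le q\}+\mathrm{span}_k\{x^a\partial_q : |a|>1,\ a_l=0\text{ for } l>q,\ a_q\le 1\}$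 (the full-varied Borel subalgebra), and $B_{\mathrm{gen}}=\mathrm{Stab}_G(\mathfrak b_n)=\{g\in G : g(\mathfrak b_n)=\mathfrak b_n\}$; * $B_0\subset G$, the image under $\Phi$ of the group of linear substitutions $x_j\mapsto\sum_{i\le j}M_{ij}x_i$ with $M$ an invertible upper-triangular $n\times n$ matrix over $k$; * $U=\{g\in G : (g-\mathrm{id})(W(n)_i)\subset W(n)_{i+1}\text{ for all } i\}$; * $U_n=\{g\in U : g=\Phi(\varphi)\text{ with }\varphi\in\mathrm{Aut}_k(A(n)),\ (\varphi-\mathrm{id})(x_i)\in (k+kx_i)\,k[x_1,\dots,x_{i-1}]\text{ for } i=1,\dots,n\}$. Then $\Phi$ is injective, and 1. every element of $B_{\mathrm{gen}}$ is $\Phi(\varphi)$ for some $\varphi\in\mathrm{Aut}_k(A(n))$ in the isotropy group of the flag $k[x_1,\dots,x_n]\supset k[x_1,\dots,x_{n-1}]\supset\cdots\supset k[x_1]$, i.e. with $\varphi(k[x_1,\dots,x_m])=k[x_1,\dots,x_m]$ for $1\le m\le n$; thus $B_{\mathrm{gen}}$ can be regarded as a subgroup of this isotropy group; 2. $B_{\mathrm{gen}}=B_0\ltimes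 U_n$ (internal semidirect product, with $U_n$ normal in $B_{\mathrm{gen}}$). -/

import Mathlib

noncomputable section

/-- Automorphisms of a Lie algebra form a group under composition: `(g * h) x = g (h x)`. -/
instance LieEquiv.instGroupAut {R L : Type*} [CommRing R] [LieRing L] [LieAlgebra R L] :
    Group (L ≃ₗ⁅R⁆ L) where
  mul g h := h.trans g
  one := LieEquiv.refl
  inv g := g.symm
  mul_assoc _ _ _ := rfl
  one_mul _ := rfl
  mul_one _ := rfl
  inv_mul_cancel g := g.self_trans_symm

namespace JacobsonWitt

/-- The ideal `(T₁ᵖ, …, Tₙᵖ)` of `k[T₁, …, Tₙ]`. -/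
def truncIdeal (k : Type*) [Field k] (p n : ℕ) : Ideal (MvPolynomial (Fin n) k) :=
  Ideal.span (Set.range fun i : Fin n => (MvPolynomial.X i : MvPolynomial (Fin n) k) ^ p)

/-- The truncated polynomial algebra `A(n) = k[T₁, …, Tₙ] / (T₁ᵖ, …, Tₙᵖ)`.
The indices `1, …, n` are represented by `Fin n`. -/
def TruncPoly (k : Type*) [Field k] (p n : ℕ) : Type _ :=
  MvPolynomial (Fin n) k ⧸ truncIdeal k p n

instance (k : Type*) [Field k] (p n : ℕ) : CommRing (TruncPoly k p n) :=
  inferInstanceAs (CommRing (MvPolynomial (Fin n) k ⧸ truncIdeal k p n))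

instance (k : Type*) [Field k] (p n : ℕ) : Algebra k (TruncPoly k p n) :=
  inferInstanceAs (Algebra k (MvPolynomial (Fin n) k ⧸ truncIdeal k p n))

/-- The quotient map `k[T₁, …, Tₙ] → A(n)`. -/
def toTrunc (k : Type*) [Field k] (p n : ℕ) : MvPolynomial (Fin n) k →ₐ[k] TruncPoly k p n :=
  Ideal.Quotient.mkₐ k (truncIdeal k p n)

theorem toTrunc_surjective (k : Type*) [Field k] (p n : ℕ) :
    Function.Surjective (toTrunc k p n) :=
  Ideal.Quotient.mkₐ_surjective k (truncIdeal k p n)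

theorem toTrunc_eq_zero_iff (k : Type*) [Field k] (p n : ℕ) (f : MvPolynomial (Fin n) k) :
    toTrunc k p n f = 0 ↔ f ∈ truncIdeal k p n :=
  Ideal.Quotient.eq_zero_iff_mem

/-- The Jacobson-Witt algebra `W(n)`: all `k`-derivations of `A(n)`, with the commutator bracket. -/
abbrev Witt (k : Type*) [Field k] (p n : ℕ) : Type _ :=
  Derivation k (TruncPoly k p n) (TruncPoly k p n)

/-- The automorphism group `Aut(A(n))` of the `k`-algebra `A(n)`. -/
abbrev AutA (k : Type*) [Field k] (p n : ℕ) : Type _ := TruncPoly k p n ≃ₐ[k] TruncPoly k p n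

/-- The group `G = Aut(W(n))` of Lie algebra automorphisms of `W(n)`. -/
abbrev AutW (k : Type*) [Field k] (p n : ℕ) : Type _ := Witt k p n ≃ₗ⁅k⁆ Witt k p n

section Basic

variable (k : Type*) [Field k] (p n : ℕ)

/-- The generator `x_i` of `A(n)`. -/
def gen (i : Fin n) : TruncPoly k p n := toTrunc k p n (MvPolynomial.X i)

/-- The monomial `x^a = x_1^{a_1} ⋯ x_n^{a_n}`. -/
def xpow (a : Fin n → ℕ) : TruncPoly k p n := ∏ i, gen k p n i ^ a i

theorem pderiv_mem [CharP k p] (i : Fin n) (f : MvPolynomial (Fin n) k)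
    (hf : f ∈ truncIdeal k p n) : MvPolynomial.pderiv i f ∈ truncIdeal k p n := by
  unfold truncIdeal at hf ⊢
  induction hf using Submodule.span_induction with
  | mem x hx =>
    obtain ⟨j, rfl⟩ := hx
    simp [Derivation.leibniz_pow]
  | zero => simp
  | add x y _ _ hx hy => rw [map_add]; exact add_mem hx hy
  | smul a x hx' hx =>
    rw [smul_eq_mul, Derivation.leibniz, smul_eq_mul, smul_eq_mul]
    exact add_mem (Ideal.mul_mem_left _ _ hx) (Ideal.mul_mem_right _ _ hx')

/-- The derivation `∂_i` of `A(n)` induced by `∂/∂T_i`. -/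
def del [CharP k p] (i : Fin n) : Witt k p n :=
  Derivation.liftOfSurjective (toTrunc_surjective k p n) (d := MvPolynomial.pderiv i) (by
    intro x hx
    rw [toTrunc_eq_zero_iff] at hx ⊢
    exact pderiv_mem k p n i x hx)

theorem del_gen [CharP k p] (i j : Fin n) : del k p n i (gen k p n j) = if i = j then 1 else 0 := by
  rw [gen, del, Derivation.liftOfSurjective_apply, MvPolynomial.pderiv_X, Pi.single_apply]
  split_ifs <;> simp_all

/-- The homogeneous component `W(n)_[s]`, spanned by the `x^a ∂_j` with `|a| = s + 1`. -/
def grade [CharP k p] (s : ℤ) : Submodule k (Witt k p n) :=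
  Submodule.span k {D | ∃ (a : Fin n → ℕ) (j : Fin n), (∀ l, a l < p) ∧
    ((∑ l, a l : ℕ) : ℤ) = s + 1 ∧ D = xpow k p n a • del k p n j}

/-- The standard filtration `W(n)_i = ∑_{j ≥ i} W(n)_[j]`. -/
def filt [CharP k p] (i : ℤ) : Submodule k (Witt k p n) :=
  ⨆ (j : ℤ) (_ : i ≤ j), grade k p n j

/-- The full-varied Borel space `𝔟_n`: the sum of `W(n)_[-1]`, spanned by all `∂_q`, of the standard
Borel subalgebra of `W(n)_[0]`, spanned by the `x_i ∂_q` with `i ≤ q`, and of the span of the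
`x^a ∂_q` with `|a| > 1`, where `x^a` involves only `x_1, …, x_q` and `a_q ∈ {0, 1}`. -/
def borelFull [CharP k p] : Submodule k (Witt k p n) :=
  grade k p n (-1) ⊔
  Submodule.span k {D | ∃ i q : Fin n, i ≤ q ∧ D = gen k p n i • del k p n q} ⊔
  Submodule.span k {D | ∃ (a : Fin n → ℕ) (q : Fin n), (∀ l, a l < p) ∧ (∀ l, q < l → a l = 0) ∧
    a q ≤ 1 ∧ 1 < ∑ l, a l ∧ D = xpow k p n a • del k p n q}

/-- `B_gen`, the stabilizer of `𝔟_n` in `G = Aut(W(n))`. -/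
def Bgen [CharP k p] : Subgroup (AutW k p n) where
  carrier := {g | (borelFull k p n).map (g : Witt k p n →ₗ[k] Witt k p n) = borelFull k p n}
  mul_mem' := by
    intro g h hg hh
    simp only [Set.mem_ofPred_eq] at hg hh ⊢
    conv_rhs => rw [← hg, ← hh, ← Submodule.map_comp]
    rfl
  one_mem' := Submodule.map_id _
  inv_mem' := by
    intro g hg
    simp only [Set.mem_ofPred_eq] at hg ⊢
    conv_lhs => rw [← hg, ← Submodule.map_comp]
    convert Submodule.map_id _
    ext x : 1
    exact g.symm_apply_apply x

/-- The automorphism `D ↦ φ ∘ D ∘ φ⁻¹` of `W(n)` induced by an automorphism `φ` of `A(n)`. -/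
def conj : AutA k p n →* AutW k p n where
  toFun φ :=
    { toFun := fun D => Derivation.mk'
        (φ.toLinearMap ∘ₗ (D : TruncPoly k p n →ₗ[k] TruncPoly k p n) ∘ₗ φ.symm.toLinearMap)
        (by intro a b; simp)
      invFun := fun D => Derivation.mk'
        (φ.symm.toLinearMap ∘ₗ (D : TruncPoly k p n →ₗ[k] TruncPoly k p n) ∘ₗ φ.toLinearMap)
        (by intro a b; simp)
      map_add' := fun D E => by ext x; exact map_add φ _ _
      map_smul' := fun c D => by ext x; exact map_smul φ c _
      map_lie' := by
        intro D E
        ext x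
        change φ (⁅D, E⁆ (φ.symm x)) = _
        rw [Derivation.commutator_apply, Derivation.commutator_apply, map_sub]
        change _ = φ (D (φ.symm (φ (E (φ.symm x))))) - φ (E (φ.symm (φ (D (φ.symm x)))))
        rw [φ.symm_apply_apply, φ.symm_apply_apply]
      left_inv := fun D => by
        ext x
        change φ.symm (φ (D (φ.symm (φ x)))) = D x
        rw [φ.symm_apply_apply, φ.symm_apply_apply]
      right_inv := fun D => by
        ext x
        change φ (φ.symm (D (φ (φ.symm x)))) = D x
        rw [φ.apply_symm_apply, φ.apply_symm_apply] }
  map_one' := by ext D x; rfl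
  map_mul' := by intro φ ψ; ext D x; rfl

theorem conj_apply (φ : AutA k p n) (D : Witt k p n) (f : TruncPoly k p n) :
    conj k p n φ D f = φ (D (φ.symm f)) := rfl

/-- The subalgebra `k[x_1, …, x_m]` of `A(n)`. -/
def subPoly (m : ℕ) : Subalgebra k (TruncPoly k p n) :=
  Algebra.adjoin k {f | ∃ l : Fin n, (l : ℕ) < m ∧ f = gen k p n l}

/-- The isotropy group in `Aut(A(n))` of the flag `k[x_1, …, x_n] ⊃ ⋯ ⊃ k[x_1]`. -/
def flagIsotropy : Subgroup (AutA k p n) where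
  carrier := {φ | ∀ m, 1 ≤ m → m ≤ n →
    (subPoly k p n m).map (φ : TruncPoly k p n →ₐ[k] TruncPoly k p n) = subPoly k p n m}
  mul_mem' := by
    intro φ ψ hφ hψ m h1 h2
    conv_rhs => rw [← hφ m h1 h2, ← hψ m h1 h2, Subalgebra.map_map]
    rfl
  one_mem' := fun m _ _ => Subalgebra.map_id _
  inv_mem' := by
    intro φ hφ m h1 h2
    conv_lhs => rw [← hφ m h1 h2, Subalgebra.map_map]
    convert Subalgebra.map_id _
    ext x : 1
    exact φ.symm_apply_apply x

/-- The linear substitutions `x_j ↦ ∑_i M_{ij} x_i` with `M` an invertible upper-triangular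
matrix, as a subgroup of `Aut(A(n))`. -/
def upperLinear : Subgroup (AutA k p n) where
  carrier := {φ | ∃ M : Matrix (Fin n) (Fin n) k, IsUnit M ∧ (∀ i j, j < i → M i j = 0) ∧
    ∀ j, φ (gen k p n j) = ∑ i, M i j • gen k p n i}
  mul_mem' := by
    rintro φ ψ ⟨M, hM, hMu, hMφ⟩ ⟨N, hN, hNu, hNψ⟩
    refine ⟨M * N, hM.mul hN, fun i j hij => ?_, fun j => ?_⟩
    · exact Matrix.BlockTriangular.mul (b := id) (M := M) (N := N)
        (fun i j h => hMu i j h) (fun i j h => hNu i j h) hij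
    · simp only [AlgEquiv.mul_apply, hNψ, map_sum, map_smul, hMφ, Finset.smul_sum, smul_smul,
        Matrix.mul_apply, Finset.sum_smul]
      rw [Finset.sum_comm]
      simp only [mul_comm]
  one_mem' := by
    refine ⟨1, isUnit_one, fun i j h => Matrix.one_apply_ne h.ne', fun j => ?_⟩
    simp [Matrix.one_apply]
  inv_mem' := by
    rintro φ ⟨M, hM, hMu, hMφ⟩
    have hdet := (Matrix.isUnit_iff_isUnit_det M).1 hM
    let _ := M.invertibleOfIsUnitDet hdet
    refine ⟨M⁻¹, ?_, fun i j hij => ?_, fun j => ?_⟩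
    · exact (Matrix.isUnit_nonsing_inv_iff).2 hM
    · exact Matrix.blockTriangular_inv_of_blockTriangular (b := id) (M := M)
        (fun i j h => hMu i j h) hij
    · change φ.symm (gen k p n j) = _
      rw [AlgEquiv.symm_apply_eq]
      simp only [map_sum, map_smul, hMφ, Finset.smul_sum, smul_smul]
      rw [Finset.sum_comm]
      simp only [← Finset.sum_smul]
      have : ∀ i, ∑ l, M⁻¹ l j * M i l = (1 : Matrix (Fin n) (Fin n) k) i j := by
        intro i
        rw [← Matrix.mul_nonsing_inv M hdet, Matrix.mul_apply]
        simp only [mul_comm]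
      simp [this, Matrix.one_apply]

/-- `B_0`, the subgroup of `G_0 ≅ GL(n, k)` corresponding to the invertible upper-triangular
matrices. -/
def B0 : Subgroup (AutW k p n) := (upperLinear k p n).map (conj k p n)

theorem gen_pow (i : Fin n) : gen k p n i ^ p = 0 := by
  rw [gen, ← map_pow, toTrunc_eq_zero_iff]
  exact Ideal.subset_span ⟨i, rfl⟩

theorem adjoin_gen : Algebra.adjoin k (Set.range (gen k p n)) = ⊤ := by
  have h := congrArg (Subalgebra.map (toTrunc k p n))
    (MvPolynomial.adjoin_range_X (R := k) (σ := Fin n))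
  rw [AlgHom.map_adjoin, ← Set.range_comp, Algebra.map_top,
    (AlgHom.range_eq_top _).2 (toTrunc_surjective k p n)] at h
  exact h

theorem finite_truncPoly [hp : Fact p.Prime] : Module.Finite k (TruncPoly k p n) := by
  have : Algebra.FiniteType k (TruncPoly k p n) :=
    Algebra.FiniteType.of_surjective (toTrunc k p n) (toTrunc_surjective k p n)
  have hint : Algebra.IsIntegral k (TruncPoly k p n) := by
    rw [← integralClosure_eq_top_iff, eq_top_iff, ← adjoin_gen]
    refine Algebra.adjoin_le ?_
    rintro _ ⟨i, rfl⟩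
    refine IsIntegral.of_pow hp.out.pos ?_
    rw [gen_pow]
    exact isIntegral_zero
  exact Algebra.IsIntegral.finite

theorem finite_witt [Fact p.Prime] : Module.Finite k (Witt k p n) := by
  have := finite_truncPoly k p n
  let ev : Witt k p n →ₗ[k] (Fin n → TruncPoly k p n) :=
    { toFun := fun D i => D (gen k p n i)
      map_add' := fun _ _ => rfl
      map_smul' := fun _ _ => rfl }
  refine Module.Finite.of_injective ev fun D E h => ?_
  refine Derivation.ext_of_adjoin_eq_top _ (adjoin_gen k p n) ?_
  rintro _ ⟨i, rfl⟩
  exact congrFun h i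

/-- A linear automorphism of a finite-dimensional space that maps a subspace into itself
maps its inverse into itself. -/
theorem symm_mem_of_mapsTo {V : Type*} [AddCommGroup V] [Module k V] [Module.Finite k V]
    (e : V ≃ₗ[k] V) (S : Submodule k V) (h : ∀ v ∈ S, e v ∈ S) : ∀ v ∈ S, e.symm v ∈ S := by
  have hS : S.map (e : V →ₗ[k] V) = S :=
    Submodule.eq_of_le_of_finrank_eq (by rintro _ ⟨v, hv, rfl⟩; exact h v hv)
      (LinearEquiv.finrank_map_eq e S)
  intro v hv
  rw [← hS] at hv
  obtain ⟨w, hw, rfl⟩ := hv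
  simpa using hw

theorem filt_succ_le [CharP k p] (i : ℤ) : filt k p n (i + 1) ≤ filt k p n i :=
  iSup₂_le fun j hj => le_iSup₂_of_le j (by omega) le_rfl

theorem filt_stable [CharP k p] {g : AutW k p n}
    (hg : ∀ i : ℤ, ∀ D ∈ filt k p n i, g D - D ∈ filt k p n (i + 1)) (i : ℤ) :
    ∀ D ∈ filt k p n i, g D ∈ filt k p n i := fun D hD => by
  have h := add_mem (filt_succ_le k p n i (hg i D hD)) hD
  have h2 : g D - D + D = g D := sub_add_cancel _ _
  exact h2 ▸ h

/-- `U = {g ∈ G | (g - id)(W(n)_i) ⊂ W(n)_{i+1} for all i}`. -/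
def U [CharP k p] [Fact p.Prime] : Subgroup (AutW k p n) where
  carrier := {g | ∀ i : ℤ, ∀ D ∈ filt k p n i, g D - D ∈ filt k p n (i + 1)}
  mul_mem' := by
    intro g h hg hh i D hD
    have h1 := filt_stable k p n hg (i + 1) _ (hh i D hD)
    have h2 := add_mem h1 (hg i D hD)
    have h3 : g (h D - D) + (g D - D) = (g * h) D - D := by
      have h4 : g (h D - D) = g (h D) - g D := map_sub g.toLinearEquiv (h D) D
      rw [h4]
      exact sub_add_sub_cancel _ _ _
    exact h3 ▸ h2
  one_mem' := by
    intro i D _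
    have h : (1 : AutW k p n) D - D = 0 := sub_self D
    exact h ▸ zero_mem _
  inv_mem' := by
    intro g hg i D hD
    have := finite_witt k p n
    have h1 := symm_mem_of_mapsTo k g.toLinearEquiv (filt k p n (i + 1))
      (filt_stable k p n hg (i + 1)) _ (hg i D hD)
    have h2 := neg_mem h1
    change g.symm D - D ∈ _
    have h3 : -g.toLinearEquiv.symm (g D - D) = g.symm D - D := by
      have h4 : g.toLinearEquiv.symm (g D - D) = g.symm (g D) - g.symm D :=
        map_sub g.toLinearEquiv.symm (g D) D
      rw [h4, g.symm_apply_apply]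
      exact neg_sub _ _
    exact h3 ▸ h2

/-- The subspace `(k + k x_i) k[x_1, …, x_{i-1}]` of `A(n)`. -/
def linPart (i : Fin n) : Submodule k (TruncPoly k p n) :=
  (Submodule.span k {1} ⊔ Submodule.span k {gen k p n i}) *
    Subalgebra.toSubmodule (subPoly k p n i)

theorem subPoly_le_linPart (i : Fin n) :
    Subalgebra.toSubmodule (subPoly k p n i) ≤ linPart k p n i := fun f hf => by
  have h1 : (1 : TruncPoly k p n) ∈ Submodule.span k {1} ⊔ Submodule.span k {gen k p n i} :=
    Submodule.mem_sup_left (Submodule.mem_span_singleton_self _)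
  exact one_mul f ▸ Submodule.mul_mem_mul h1 hf

theorem gen_mem_linPart (i : Fin n) : gen k p n i ∈ linPart k p n i := by
  have h1 : gen k p n i ∈ Submodule.span k {1} ⊔ Submodule.span k {gen k p n i} :=
    Submodule.mem_sup_right (Submodule.mem_span_singleton_self _)
  exact mul_one (gen k p n i) ▸ Submodule.mul_mem_mul h1
    ((subPoly k p n i).one_mem : 1 ∈ Subalgebra.toSubmodule (subPoly k p n i))

theorem linPart_le (i : Fin n) (m : ℕ) (h : (i : ℕ) < m) :
    linPart k p n i ≤ Subalgebra.toSubmodule (subPoly k p n m) := by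
  have hle : subPoly k p n i ≤ subPoly k p n m :=
    Algebra.adjoin_mono fun f ⟨l, hl, hf⟩ => ⟨l, hl.trans h, hf⟩
  refine Submodule.mul_le.2 fun a ha b hb => ?_
  refine Subalgebra.mul_mem _ ?_ (hle hb)
  have h2 : Submodule.span k {1} ⊔ Submodule.span k {gen k p n i} ≤
      Subalgebra.toSubmodule (subPoly k p n m) := by
    refine sup_le ?_ ?_ <;> rw [Submodule.span_singleton_le_iff_mem]
    · exact Subalgebra.one_mem _
    · exact Algebra.subset_adjoin ⟨i, h, rfl⟩
  exact h2 ha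

theorem subPoly_stable {φ : AutA k p n}
    (hφ : ∀ i, φ (gen k p n i) - gen k p n i ∈ linPart k p n i) (m : ℕ) :
    ∀ f ∈ subPoly k p n m, φ f ∈ subPoly k p n m := by
  have : subPoly k p n m ≤
      (subPoly k p n m).comap (φ : TruncPoly k p n →ₐ[k] TruncPoly k p n) := by
    refine Algebra.adjoin_le ?_
    rintro _ ⟨l, hl, rfl⟩
    have := add_mem (linPart_le k p n l m hl (hφ l)) (linPart_le k p n l m hl
      (gen_mem_linPart k p n l))
    simpa using this
  exact fun f hf => this hf

theorem linPart_stable {φ : AutA k p n}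
    (hφ : ∀ i, φ (gen k p n i) - gen k p n i ∈ linPart k p n i) (i : Fin n) :
    ∀ f ∈ linPart k p n i, φ f ∈ linPart k p n i := by
  have hx : φ (gen k p n i) ∈ linPart k p n i := by
    simpa using add_mem (hφ i) (gen_mem_linPart k p n i)
  have hmul : ∀ a ∈ linPart k p n i, ∀ b ∈ subPoly k p n i, a * b ∈ linPart k p n i := by
    intro a ha b hb
    have h := Submodule.mul_mem_mul ha (show b ∈ Subalgebra.toSubmodule (subPoly k p n i) from hb)
    rwa [linPart, mul_assoc, Subalgebra.isIdempotentElem_toSubmodule] at h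
  have h1 : linPart k p n i ≤ (linPart k p n i).comap φ.toLinearMap := by
    refine Submodule.mul_le.2 fun a ha b hb => ?_
    change φ (a * b) ∈ linPart k p n i
    rw [map_mul]
    refine hmul _ ?_ _ (subPoly_stable k p n hφ i b hb)
    have h2 : Submodule.span k {1} ⊔ Submodule.span k {gen k p n i} ≤
        (linPart k p n i).comap φ.toLinearMap := by
      refine sup_le ?_ ?_ <;> rw [Submodule.span_singleton_le_iff_mem]
      · change φ 1 ∈ linPart k p n i
        rw [map_one]
        exact subPoly_le_linPart k p n i (Subalgebra.one_mem _)
      · exact hx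
    exact h2 ha
  exact fun f hf => h1 hf

/-- The automorphisms `φ` of `A(n)` with `(φ - id)(x_i) ∈ (k + k x_i) k[x_1, …, x_{i-1}]`
for all `i`. -/
def triangular [Fact p.Prime] : Subgroup (AutA k p n) where
  carrier := {φ | ∀ i, φ (gen k p n i) - gen k p n i ∈ linPart k p n i}
  mul_mem' := by
    intro φ ψ hφ hψ i
    have h := add_mem (linPart_stable k p n hφ i _ (hψ i)) (hφ i)
    rw [map_sub] at h
    simpa using h
  one_mem' := by
    intro i
    simp
  inv_mem' := by
    intro φ hφ i
    have := finite_truncPoly k p n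
    have h := neg_mem (symm_mem_of_mapsTo k φ.toLinearEquiv (linPart k p n i)
      (linPart_stable k p n hφ i) _ (hφ i))
    change φ.symm (gen k p n i) - gen k p n i ∈ _
    have h3 : φ.toLinearEquiv.symm (φ (gen k p n i) - gen k p n i) =
        gen k p n i - φ.symm (gen k p n i) := by
      rw [map_sub]
      congr 1
      exact φ.symm_apply_apply _
    rw [h3] at h
    simpa using h

/-- `U_n`: those `g ∈ U` which, viewed as automorphisms of `A(n)`, satisfy
`(g - id)(x_i) ∈ (k + k x_i) k[x_1, …, x_{i-1}]` for all `i`. -/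
def Un [CharP k p] [Fact p.Prime] : Subgroup (AutW k p n) :=
  U k p n ⊓ (triangular k p n).map (conj k p n)

end Basic

end JacobsonWitt

/-- `H` is the internal semidirect product `K ⋉ N`: `K` and `N` are subgroups of `H`, `N` is normal
in `H`, and every element of `H` is uniquely a product of an element of `K` and one of `N`. -/
def IsInternalSemidirect {G : Type*} [Group G] (H K N : Subgroup G) : Prop :=
  K ≤ H ∧ N ≤ H ∧ (N.subgroupOf H).Normal ∧ (K.subgroupOf H).IsComplement' (N.subgroupOf H)

end

/-! The subspace `borelFull` consists of the derivations `D` with `D x_q ∈ L_q := (k + k x_q) k[x_1,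
…, x_{q-1}]` for every `q`, and `L_q` is cut out by `∂_i f = 0` for `i > q` and `∂_q² f = 0`. The
main step is that `Bgen` is exactly the image of the group `triangular` under `conj`; both claims
about `Bgen` then reduce to triangular substitutions.

Triangular substitutions preserve every `L_q`, hence `borelFull`. Conversely, suppose `conj φ`
stabilizes `borelFull`. Then `φ(L_q)` is a `borelFull`-stable subspace. Such a subspace is
comparable with `L_q` (`le_of_borelFull_stable`), so equality of dimensions gives `φ(L_q) = L_q`.

It must also be shown that each `g ∈ Bgen` comes from some automorphism of `A(n)`. This is done
directly, without a description of all of `Aut(W(n))`. Let `t` be the last index, `J = constIdeal`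
and `I = affineIdeal`. Every abelian ideal of `borelFull` lies in `J`, and every ideal `K` with `[K,
K] ⊆ J` lies in `I`; hence `g` preserves both. The bracket of `I` with `J` encodes multiplication in
`k[x_1, …, x_{n-1}]`, so the action of `g` on them yields an automorphism `η` of `A(n)`
(`exists_conj_eq_on_affineIdeal`). After division by `conj η`, `g` fixes `J` and sends `x_t ∂_t` to
`(x_t + c) ∂_t`. Weights for these operators determine `g` on monomial derivations, and brackets
that see `(x_t + c)^p = c^p` force `c = 0`, whence `g = 1` (`eq_one_of_fixes`).

For the semidirect product, the Jacobian matrix at the origin of a triangular automorphism supplies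
its factor in `B0`; the other factor is the identity modulo degree 2 on generators, which puts it in
`U`. -/

noncomputable section

namespace JacobsonWitt

open MvPolynomial (coeff)

variable {k : Type*} [Field k] {p n : ℕ}

local notation "𝐱" => gen k p n
local notation "∂" => del k p n

/-! ### Generators of `A(n)`, the augmentation, and derivations in coordinates -/

section Generators

/-- The algebra homomorphism from `A(n)` sending `x_i` to `y i`, where all `y i ^ p` vanish. -/
def liftHom {B : Type*} [CommRing B] [Algebra k B] (y : Fin n → B) (hy : ∀ i, y i ^ p = 0) :
    TruncPoly k p n →ₐ[k] B :=
  Ideal.Quotient.liftₐ (truncIdeal k p n) (MvPolynomial.aeval y) (by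
    intro a ha
    have : truncIdeal k p n ≤ RingHom.ker (MvPolynomial.aeval (R := k) y) := by
      refine Ideal.span_le.2 ?_
      rintro _ ⟨i, rfl⟩
      simp [RingHom.mem_ker, hy]
    exact this ha)

theorem liftHom_gen {B : Type*} [CommRing B] [Algebra k B] (y : Fin n → B)
    (hy : ∀ i, y i ^ p = 0) (i : Fin n) : liftHom y hy (𝐱 i) = y i :=
  (Ideal.Quotient.lift_mk _ _ _).trans (MvPolynomial.aeval_X y i)

theorem algHom_ext_gen {B : Type*} [CommRing B] [Algebra k B] {f g : TruncPoly k p n →ₐ[k] B}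
    (h : ∀ i, f (𝐱 i) = g (𝐱 i)) : f = g := by
  refine AlgHom.ext_of_adjoin_eq_top (adjoin_gen k p n) ?_
  rintro _ ⟨i, rfl⟩
  exact h i

/-- The augmentation `A(n) → k`, sending all `x_i` to `0`. -/
def aug [hp : Fact p.Prime] : TruncPoly k p n →ₐ[k] k :=
  liftHom (fun _ => 0) fun _ => zero_pow hp.out.ne_zero

@[simp]
theorem aug_gen [Fact p.Prime] (i : Fin n) : aug (𝐱 i) = 0 := liftHom_gen _ _ _

instance [Fact p.Prime] : Nontrivial (TruncPoly k p n) :=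
  ⟨1, 0, fun h => one_ne_zero (α := k) (by simpa using congrArg (aug (p := p) (n := n)) h)⟩

theorem algebraMap_injective [Fact p.Prime] :
    Function.Injective (algebraMap k (TruncPoly k p n)) :=
  (algebraMap k (TruncPoly k p n)).injective

theorem charP_truncPoly [Fact p.Prime] [CharP k p] : CharP (TruncPoly k p n) p :=
  charP_of_injective_algebraMap algebraMap_injective p

/-- Frobenius is additive and kills the generators, so only the constant term survives. This decides
which elements may serve as images of generators in `liftHom`, and it gives `(x_t + c)^p = c^p`. -/
theorem pow_eq_aug [hp : Fact p.Prime] [CharP k p] (f : TruncPoly k p n) :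
    f ^ p = algebraMap k _ (aug f ^ p) := by
  have := charP_truncPoly (k := k) (p := p) (n := n)
  have := ExpChar.prime (R := TruncPoly k p n) hp.out
  have hf : f ∈ Algebra.adjoin k (Set.range 𝐱) := by rw [adjoin_gen]; trivial
  induction hf using Algebra.adjoin_induction with
  | mem x hx =>
    obtain ⟨i, rfl⟩ := hx
    rw [gen_pow, aug_gen, zero_pow hp.out.ne_zero, map_zero]
  | algebraMap r => simp
  | add x y _ _ hx hy =>
    have := ExpChar.prime (R := k) hp.out
    rw [add_pow_expChar, hx, hy, map_add, add_pow_expChar, map_add]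
  | mul x y _ _ hx hy => rw [mul_pow, hx, hy, map_mul, mul_pow, map_mul]

theorem pow_eq_zero_iff_aug [hp : Fact p.Prime] [CharP k p] (f : TruncPoly k p n) :
    f ^ p = 0 ↔ aug f = 0 := by
  rw [pow_eq_aug, ← map_zero (algebraMap k (TruncPoly k p n)), algebraMap_injective.eq_iff,
    pow_eq_zero_iff hp.out.ne_zero]

theorem witt_ext_gen {D E : Witt k p n} (h : ∀ i, D (𝐱 i) = E (𝐱 i)) : D = E := by
  refine Derivation.ext_of_adjoin_eq_top _ (adjoin_gen k p n) ?_
  rintro _ ⟨i, rfl⟩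
  exact h i

theorem witt_sum_apply {ι : Type*} (s : Finset ι) (E : ι → Witt k p n) (f : TruncPoly k p n) :
    (∑ i ∈ s, E i) f = ∑ i ∈ s, E i f :=
  map_sum ({ toFun := fun D => D f, map_zero' := rfl, map_add' := fun _ _ => rfl } :
    Witt k p n →+ TruncPoly k p n) E s

variable [CharP k p]

theorem witt_eq_sum (D : Witt k p n) : D = ∑ i, D (𝐱 i) • ∂ i := by
  refine witt_ext_gen fun j => ?_
  rw [witt_sum_apply]
  simp [del_gen]

theorem witt_apply_eq_sum (D : Witt k p n) (f : TruncPoly k p n) :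
    D f = ∑ i, D (𝐱 i) * ∂ i f := by
  conv_lhs => rw [witt_eq_sum D]
  rw [witt_sum_apply]
  simp

theorem del_comm (i j : Fin n) (f : TruncPoly k p n) : ∂ i (∂ j f) = ∂ j (∂ i f) := by
  have h : ⁅∂ i, ∂ j⁆ = 0 := witt_ext_gen fun l => by
    rw [Derivation.commutator_apply, del_gen, del_gen]
    split_ifs <;> simp
  have h2 := Derivation.congr_fun h f
  rw [Derivation.commutator_apply] at h2
  exact sub_eq_zero.1 h2

end Generators

/-! ### Reduced monomials and partial derivatives -/

section Monomials

theorem toTrunc_monomial (d : Fin n →₀ ℕ) (c : k) :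
    toTrunc k p n (MvPolynomial.monomial d c) = c • xpow k p n d := by
  rw [MvPolynomial.monomial_eq, map_mul, MvPolynomial.C_eq_smul_one, map_smul, map_one,
    smul_one_mul, Finsupp.prod_fintype _ _ (by simp), map_prod]
  simp [xpow, gen]

theorem xpow_eq_zero {a : Fin n → ℕ} {i : Fin n} (h : p ≤ a i) : xpow k p n a = 0 := by
  refine Finset.prod_eq_zero (Finset.mem_univ i) ?_
  rw [← Nat.sub_add_cancel h, pow_add, gen_pow, mul_zero]

theorem xpow_eq_one {a : Fin n → ℕ} (h : ∑ i, a i = 0) : xpow k p n a = 1 := by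
  have h1 : ∀ i, a i = 0 := by simpa using h
  simp [xpow, h1]

theorem exists_xpow_eq_gen {a : Fin n → ℕ} (h : ∑ i, a i = 1) :
    ∃ i, a i ≠ 0 ∧ xpow k p n a = 𝐱 i := by
  obtain ⟨i, hi⟩ : ∃ i, a i ≠ 0 := by
    by_contra! hc
    simp [hc] at h
  have hrest := Finset.add_sum_erase Finset.univ a (Finset.mem_univ i)
  have h0 : ∑ l ∈ Finset.univ.erase i, a l = 0 := by omega
  have hi1 : a i = 1 := by omega
  refine ⟨i, hi, ?_⟩
  rw [xpow, ← Finset.mul_prod_erase _ _ (Finset.mem_univ i), hi1, pow_one, Finset.prod_eq_one,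
    mul_one]
  intro j hj
  rw [Finset.sum_eq_zero_iff.1 h0 j hj, pow_zero]

theorem exists_reduced (f : TruncPoly k p n) : ∃ F : MvPolynomial (Fin n) k,
    toTrunc k p n F = f ∧ ∀ d i, p ≤ d i → coeff d F = 0 := by
  obtain ⟨F, rfl⟩ := toTrunc_surjective k p n f
  induction F using MvPolynomial.induction_on' with
  | monomial u a =>
    by_cases h : ∃ i, p ≤ u i
    · obtain ⟨i, hi⟩ := h
      exact ⟨0, by rw [toTrunc_monomial, xpow_eq_zero hi, smul_zero, map_zero], by simp⟩
    · refine ⟨_, rfl, fun d i hd => ?_⟩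
      rw [MvPolynomial.coeff_monomial, if_neg]
      rintro rfl
      exact h ⟨i, hd⟩
  | add F G hF hG =>
    obtain ⟨F', h1, h2⟩ := hF
    obtain ⟨G', h3, h4⟩ := hG
    refine ⟨F' + G', by rw [map_add, map_add, h1, h3], fun d i hd => ?_⟩
    rw [MvPolynomial.coeff_add, h2 d i hd, h4 d i hd, add_zero]

/-- `truncIdeal` is a monomial ideal, so membership can be tested monomial by monomial. This is the
linear independence of the reduced monomials. -/
theorem coeff_eq_zero_of_toTrunc_eq_zero {F : MvPolynomial (Fin n) k} (h : toTrunc k p n F = 0)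
    {d : Fin n →₀ ℕ} (hd : ∀ i, d i < p) : coeff d F = 0 := by
  rw [toTrunc_eq_zero_iff] at h
  have h2 : truncIdeal k p n = Ideal.span ((fun s => MvPolynomial.monomial s (1 : k)) ''
      Set.range fun i : Fin n => Finsupp.single i p) := by
    rw [truncIdeal, ← Set.range_comp]
    congr 2
    ext1 i
    exact MvPolynomial.X_pow_eq_monomial
  rw [h2, MvPolynomial.mem_ideal_span_monomial_image] at h
  by_contra hc
  obtain ⟨_, ⟨i, rfl⟩, hi⟩ := h d (MvPolynomial.mem_support_iff.2 hc)
  have := hi i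
  rw [Finsupp.single_eq_same] at this
  exact absurd (hd i) (not_lt.2 this)

theorem natCast_ne_zero_of_lt [CharP k p] {a : ℕ} (h0 : a ≠ 0) (h : a < p) : (a : k) ≠ 0 := fun hc =>
  absurd (Nat.le_of_dvd (Nat.pos_of_ne_zero h0) ((CharP.cast_eq_zero_iff k p a).1 hc)) (by omega)

theorem eq_sum_xpow {F : MvPolynomial (Fin n) k} :
    toTrunc k p n F = ∑ d ∈ F.support, coeff d F • xpow k p n d := by
  conv_lhs => rw [F.as_sum]
  rw [map_sum]
  exact Finset.sum_congr rfl fun d _ => toTrunc_monomial d _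

variable [CharP k p]

theorem toTrunc_pderiv (i : Fin n) (F : MvPolynomial (Fin n) k) :
    toTrunc k p n (MvPolynomial.pderiv i F) = ∂ i (toTrunc k p n F) := by
  rw [del, Derivation.liftOfSurjective_apply]

/-- In a reduced representative a nonzero exponent is less than `p`, hence invertible in `k`, and
differentiation loses no term containing `x_i`. -/
theorem exponent_eq_zero_of_del_eq_zero {F : MvPolynomial (Fin n) k}
    (hF : ∀ d i, p ≤ d i → coeff d F = 0) {i : Fin n} (h : ∂ i (toTrunc k p n F) = 0)
    {d : Fin n →₀ ℕ} (hd : coeff d F ≠ 0) : d i = 0 := by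
  by_contra hdi
  have hlt : ∀ j, d j < p := fun j => not_le.1 fun hj => hd (hF d j hj)
  rw [← toTrunc_pderiv] at h
  have h1 := coeff_eq_zero_of_toTrunc_eq_zero h (d := d - Finsupp.single i 1) fun j =>
    (Nat.sub_le _ _).trans_lt (hlt j)
  have h2 : d - Finsupp.single i 1 + Finsupp.single i 1 = d :=
    tsub_add_cancel_of_le (by simpa [Nat.one_le_iff_ne_zero] using hdi)
  rw [MvPolynomial.coeff_pderiv, h2] at h1
  have h3 : (((d - Finsupp.single i 1 : Fin n →₀ ℕ) i : ℕ) : k) + 1 = (d i : k) := by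
    have : (d - Finsupp.single i 1 : Fin n →₀ ℕ) i + 1 = d i := by
      simpa using Nat.sub_add_cancel (Nat.one_le_iff_ne_zero.2 hdi)
    exact_mod_cast congrArg (Nat.cast (R := k)) this
  rw [h3] at h1
  exact (mul_ne_zero hd (natCast_ne_zero_of_lt hdi (hlt i))) h1

theorem exponent_le_one_of_del_del_eq_zero {F : MvPolynomial (Fin n) k}
    (hF : ∀ d i, p ≤ d i → coeff d F = 0) {i : Fin n} (h : ∂ i (∂ i (toTrunc k p n F)) = 0)
    {d : Fin n →₀ ℕ} (hd : coeff d F ≠ 0) : d i ≤ 1 := by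
  by_contra hdi
  have hlt : ∀ j, d j < p := fun j => not_le.1 fun hj => hd (hF d j hj)
  have h2 : d - Finsupp.single i 1 + Finsupp.single i 1 = d :=
    tsub_add_cancel_of_le (by simp; omega)
  have h3 : (((d - Finsupp.single i 1 : Fin n →₀ ℕ) i : ℕ) : k) + 1 = (d i : k) := by
    have : (d - Finsupp.single i 1 : Fin n →₀ ℕ) i + 1 = d i := by simp; omega
    exact_mod_cast congrArg (Nat.cast (R := k)) this
  rw [← toTrunc_pderiv] at h
  have := exponent_eq_zero_of_del_eq_zero (F := MvPolynomial.pderiv i F) ?_ h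
    (d := d - Finsupp.single i 1) ?_
  · simp at this; omega
  · intro e j he
    rw [MvPolynomial.coeff_pderiv, hF _ j (by simp; omega), zero_mul]
  · rw [MvPolynomial.coeff_pderiv, h2, h3]
    exact mul_ne_zero hd (natCast_ne_zero_of_lt (by omega) (hlt i))

theorem mem_span_xpow_of_del {R : Set (Fin n)} {f : TruncPoly k p n} (h : ∀ i ∈ R, ∂ i f = 0) :
    f ∈ Submodule.span k {g | ∃ a : Fin n → ℕ, (∀ i, a i < p) ∧ (∀ i ∈ R, a i = 0) ∧
      g = xpow k p n a} := by
  obtain ⟨F, rfl, hF⟩ := exists_reduced f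
  rw [eq_sum_xpow]
  refine Submodule.sum_mem _ fun d hd => Submodule.smul_mem _ _ (Submodule.subset_span ?_)
  rw [MvPolynomial.mem_support_iff] at hd
  exact ⟨d, fun j => not_le.1 fun hj => hd (hF d j hj), fun i hi =>
    exponent_eq_zero_of_del_eq_zero hF (h i hi) hd, rfl⟩

theorem mem_span_xpow_of_del_del {q : Fin n} {f : TruncPoly k p n} (h : ∀ i, q < i → ∂ i f = 0)
    (hq : ∂ q (∂ q f) = 0) :
    f ∈ Submodule.span k {g | ∃ a : Fin n → ℕ, (∀ i, a i < p) ∧ (∀ i, q < i → a i = 0) ∧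
      a q ≤ 1 ∧ g = xpow k p n a} := by
  obtain ⟨F, rfl, hF⟩ := exists_reduced f
  rw [eq_sum_xpow]
  refine Submodule.sum_mem _ fun d hd => Submodule.smul_mem _ _ (Submodule.subset_span ?_)
  rw [MvPolynomial.mem_support_iff] at hd
  exact ⟨d, fun j => not_le.1 fun hj => hd (hF d j hj), fun i hi =>
    exponent_eq_zero_of_del_eq_zero hF (h i hi) hd,
    exponent_le_one_of_del_del_eq_zero hF hq hd, rfl⟩

theorem exists_algebraMap_of_del {f : TruncPoly k p n} (h : ∀ i, ∂ i f = 0) :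
    ∃ c : k, f = algebraMap k _ c := by
  have hf := mem_span_xpow_of_del (R := Set.univ) fun i _ => h i
  refine (Submodule.span_le (p := LinearMap.range (Algebra.linearMap k (TruncPoly k p n)))).2 ?_ hf
    |>.imp fun c hc => hc.symm
  rintro _ ⟨a, -, ha, rfl⟩
  exact ⟨1, by simp [xpow, ha]⟩

theorem del_xpow (i : Fin n) (a : Fin n → ℕ) :
    ∂ i (xpow k p n a) = (a i : k) • xpow k p n (Function.update a i (a i - 1)) := by
  have h1 : ∀ b : Fin n → ℕ, xpow k p n b =
      toTrunc k p n (MvPolynomial.monomial (Finsupp.equivFunOnFinite.symm b) 1) := fun b => by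
    rw [toTrunc_monomial, one_smul]; rfl
  rw [h1 a, ← toTrunc_pderiv, MvPolynomial.pderiv_monomial, one_mul, toTrunc_monomial]
  congr 2
  ext j
  rcases eq_or_ne j i with rfl | hj
  · simp
  · simp [hj]

/-- A nonzero subspace stable under all partial derivatives contains `1`. -/
theorem one_mem_of_del_stable {V : Submodule k (TruncPoly k p n)}
    (hV : ∀ i, ∀ f ∈ V, ∂ i f ∈ V) {f : TruncPoly k p n} (hf : f ∈ V) (h0 : f ≠ 0) : 1 ∈ V := by
  have key : ∀ N, ∀ f ∈ Submodule.span k {g | ∃ a : Fin n → ℕ, ∑ i, a i ≤ N ∧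
      g = xpow k p n a}, f ∈ V → f ≠ 0 → 1 ∈ V := by
    intro N
    induction N with
    | zero =>
      intro f hf hfV h0
      have h1 : f ∈ Submodule.span k {1} := by
        refine Submodule.span_mono ?_ hf
        rintro _ ⟨a, ha, rfl⟩
        exact xpow_eq_one (Nat.le_zero.1 ha)
      obtain ⟨c, rfl⟩ := Submodule.mem_span_singleton.1 h1
      have hc : c ≠ 0 := by rintro rfl; simp at h0
      simpa [smul_smul, inv_mul_cancel₀ hc] using V.smul_mem c⁻¹ hfV
    | succ N ih =>
      -- If every partial derivative vanishes, `f` is a nonzero constant; otherwise a nonzero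
      -- derivative of `f` lies in `V` and has smaller degree.
      intro f hf hfV h0
      by_cases hd : ∀ i, ∂ i f = 0
      · obtain ⟨c, rfl⟩ := exists_algebraMap_of_del hd
        have hc : c ≠ 0 := by rintro rfl; simp at h0
        simpa [Algebra.algebraMap_eq_smul_one, smul_smul, inv_mul_cancel₀ hc]
          using V.smul_mem c⁻¹ hfV
      · push Not at hd
        obtain ⟨i, hi⟩ := hd
        refine ih (∂ i f) ?_ (hV i f hfV) hi
        change f ∈ Submodule.comap (∂ i : TruncPoly k p n →ₗ[k] TruncPoly k p n)
          (Submodule.span k _)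
        refine Submodule.span_le.2 ?_ hf
        rintro _ ⟨a, ha, rfl⟩
        change ∂ i (xpow k p n a) ∈ Submodule.span k _
        rw [del_xpow]
        by_cases hai : a i = 0
        · simp [hai]
        · refine Submodule.smul_mem _ _ (Submodule.subset_span ⟨_, ?_, rfl⟩)
          rw [Finset.sum_update_of_mem (Finset.mem_univ i)]
          rw [← Finset.add_sum_erase _ _ (Finset.mem_univ i), ← Finset.sdiff_singleton_eq_erase]
            at ha
          omega
  obtain ⟨F, rfl⟩ := toTrunc_surjective k p n f
  refine key F.totalDegree _ ?_ hf h0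
  rw [eq_sum_xpow]
  refine Submodule.sum_mem _ fun d hd => Submodule.smul_mem _ _ (Submodule.subset_span ⟨d, ?_, rfl⟩)
  have := MvPolynomial.le_totalDegree hd
  rwa [Finsupp.sum_fintype _ _ (by simp)] at this

end Monomials

/-! ### The Borel subalgebra described by the spaces `linPart` -/

section Borel

theorem mul_mem_linPart {q : Fin n} {f g : TruncPoly k p n} (hf : f ∈ linPart k p n q)
    (hg : g ∈ subPoly k p n q) : f * g ∈ linPart k p n q := by
  have h := Submodule.mul_mem_mul hf (show g ∈ Subalgebra.toSubmodule (subPoly k p n q) from hg)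
  rwa [linPart, mul_assoc, Subalgebra.isIdempotentElem_toSubmodule] at h

theorem xpow_mem_subPoly {m : ℕ} {a : Fin n → ℕ} (ha : ∀ i : Fin n, m ≤ i → a i = 0) :
    xpow k p n a ∈ subPoly k p n m := by
  refine Subalgebra.prod_mem _ fun i _ => ?_
  by_cases hi : m ≤ i
  · rw [ha i hi, pow_zero]
    exact Subalgebra.one_mem _
  · exact Subalgebra.pow_mem _ (Algebra.subset_adjoin (by exact ⟨i, not_le.1 hi, rfl⟩)) _

theorem xpow_eq_mul (q : Fin n) (a : Fin n → ℕ) :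
    xpow k p n a = 𝐱 q ^ a q * xpow k p n (Function.update a q 0) := by
  simp only [xpow]
  rw [← Finset.mul_prod_erase _ _ (Finset.mem_univ q),
    ← Finset.mul_prod_erase (a := q) Finset.univ
      (fun i => 𝐱 i ^ Function.update a q 0 i) (Finset.mem_univ q),
    Function.update_self, pow_zero, one_mul]
  congr 1
  refine Finset.prod_congr rfl fun i hi => ?_
  rw [Function.update_of_ne (Finset.ne_of_mem_erase hi)]

theorem xpow_mem_linPart {q : Fin n} {a : Fin n → ℕ} (ha : ∀ i, q < i → a i = 0)
    (hq : a q ≤ 1) : xpow k p n a ∈ linPart k p n q := by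
  rw [xpow_eq_mul q]
  refine Submodule.mul_mem_mul ?_ (xpow_mem_subPoly fun i hi => ?_)
  · interval_cases a q
    · exact Submodule.mem_sup_left (by simp)
    · exact Submodule.mem_sup_right (by simp)
  · rcases eq_or_ne i q with rfl | hne
    · simp
    · rw [Function.update_of_ne hne]
      exact ha i (lt_of_le_of_ne hi hne.symm)

variable [CharP k p]

theorem del_eq_zero_of_mem_subPoly {m : ℕ} {f : TruncPoly k p n} (hf : f ∈ subPoly k p n m)
    {i : Fin n} (hi : m ≤ i) : ∂ i f = 0 := by
  induction hf using Algebra.adjoin_induction with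
  | mem x hx =>
    obtain ⟨l, hl, rfl⟩ := hx
    rw [del_gen, if_neg]
    rintro rfl
    omega
  | algebraMap r => exact Derivation.map_algebraMap _ _
  | add x y _ _ hx hy => rw [map_add, hx, hy, add_zero]
  | mul x y _ _ hx hy => simp [hx, hy]

/-- This turns the span definition into differential equations, which later arguments can test by
commuting partial derivatives. -/
theorem mem_linPart_iff {q : Fin n} {f : TruncPoly k p n} :
    f ∈ linPart k p n q ↔ (∀ i, q < i → ∂ i f = 0) ∧ ∂ q (∂ q f) = 0 := by
  constructor
  · intro hf
    induction hf using Submodule.mul_induction_on' with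
    | mem_mul_mem a ha b hb =>
      have hb0 := fun i hi => del_eq_zero_of_mem_subPoly hb (i := i) hi
      obtain ⟨c, hc, d, hd, rfl⟩ := Submodule.mem_sup.1 ha
      obtain ⟨c, rfl⟩ := Submodule.mem_span_singleton.1 hc
      obtain ⟨d, rfl⟩ := Submodule.mem_span_singleton.1 hd
      refine ⟨fun i hi => ?_, ?_⟩
      · simp [hb0 i hi.le, del_gen, hi.ne']
      · simp [hb0 q le_rfl, del_gen]
    | add x _ y _ hx hy =>
      refine ⟨fun i hi => ?_, ?_⟩
      · rw [map_add, hx.1 i hi, hy.1 i hi, add_zero]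
      · rw [map_add, map_add, hx.2, hy.2, add_zero]
  · rintro ⟨h1, h2⟩
    refine Submodule.span_le.2 ?_ (mem_span_xpow_of_del_del h1 h2)
    rintro _ ⟨a, -, ha, hq, rfl⟩
    exact xpow_mem_linPart ha hq

theorem mem_subPoly_iff {m : ℕ} {f : TruncPoly k p n} :
    f ∈ subPoly k p n m ↔ ∀ i : Fin n, m ≤ i → ∂ i f = 0 := by
  refine ⟨fun hf i hi => del_eq_zero_of_mem_subPoly hf hi, fun h => ?_⟩
  refine (Submodule.span_le (p := Subalgebra.toSubmodule (subPoly k p n m))).2 ?_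
    (mem_span_xpow_of_del (R := {i : Fin n | m ≤ i}) h)
  rintro _ ⟨a, -, ha, rfl⟩
  exact xpow_mem_subPoly ha

theorem smul_del_apply_gen (f : TruncPoly k p n) (q r : Fin n) :
    (f • ∂ q) (𝐱 r) = if q = r then f else 0 := by
  simp [del_gen]

theorem mem_borelFull_iff {D : Witt k p n} :
    D ∈ borelFull k p n ↔ ∀ q, D (𝐱 q) ∈ linPart k p n q := by
  constructor
  · intro hD q
    let S : Submodule k (Witt k p n) :=
      { carrier := {D | D (𝐱 q) ∈ linPart k p n q}
        add_mem' := fun ha hb => (linPart k p n q).add_mem ha hb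
        zero_mem' := zero_mem (linPart k p n q)
        smul_mem' := fun c _ ha => Submodule.smul_mem (linPart k p n q) c ha }
    have hS : ∀ f r, f ∈ linPart k p n r → f • ∂ r ∈ S := fun f r hf => by
      change _ ∈ linPart k p n q
      rw [smul_del_apply_gen]
      split_ifs with h
      · exact h ▸ hf
      · exact zero_mem _
    have : borelFull k p n ≤ S := by
      refine sup_le (sup_le ?_ ?_) ?_ <;> refine Submodule.span_le.2 ?_
      · rintro _ ⟨a, j, -, ha, rfl⟩
        have ha2 : ∑ l, a l = 0 := by omega
        have ha' : ∀ l, a l = 0 := by simpa using ha2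
        exact hS _ _ (xpow_mem_linPart (fun i _ => ha' i) (by simp [ha']))
      · rintro _ ⟨i, q, hiq, rfl⟩
        refine hS _ _ (mem_linPart_iff.2 ⟨fun j hj => ?_, ?_⟩)
        · rw [del_gen, if_neg (hiq.trans_lt hj).ne']
        · rw [del_gen]
          split_ifs <;> simp
      · rintro _ ⟨a, r, -, h1, h2, -, rfl⟩
        exact hS _ _ (xpow_mem_linPart h1 h2)
    exact this hD
  · intro h
    rw [witt_eq_sum D]
    refine Submodule.sum_mem _ fun q _ => ?_
    let S : Submodule k (TruncPoly k p n) :=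
      { carrier := {f | f • ∂ q ∈ borelFull k p n}
        add_mem' := fun {a b} ha hb => by
          change (a + b) • ∂ q ∈ borelFull k p n
          rw [add_smul]; exact add_mem ha hb
        zero_mem' := by
          change (0 : TruncPoly k p n) • ∂ q ∈ borelFull k p n
          rw [zero_smul]; exact zero_mem _
        smul_mem' := fun c a ha => by
          change (c • a) • ∂ q ∈ borelFull k p n
          rw [smul_assoc]; exact Submodule.smul_mem _ c ha }
    obtain ⟨h1, h2⟩ := mem_linPart_iff.1 (h q)
    refine (Submodule.span_le (p := S)).2 ?_ (mem_span_xpow_of_del_del h1 h2)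
    rintro _ ⟨a, hap, ha, haq, rfl⟩
    change _ ∈ borelFull k p n
    rcases lt_trichotomy (∑ l, a l) 1 with hs | hs | hs
    · refine Submodule.mem_sup_left (Submodule.mem_sup_left (Submodule.subset_span
        ⟨a, q, hap, ?_, rfl⟩))
      rw [Nat.lt_one_iff.1 hs]; simp
    · obtain ⟨i, hi, hx⟩ := exists_xpow_eq_gen (k := k) (p := p) hs
      refine Submodule.mem_sup_left (Submodule.mem_sup_right (Submodule.subset_span
        ⟨i, q, not_lt.1 fun hq => hi (ha i hq), by rw [hx]⟩))
    · exact Submodule.mem_sup_right (Submodule.subset_span ⟨a, q, hap, ha, haq, hs, rfl⟩)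

theorem smul_del_mem_borelFull {f : TruncPoly k p n} {q : Fin n} (hf : f ∈ linPart k p n q) :
    f • ∂ q ∈ borelFull k p n := mem_borelFull_iff.2 fun r => by
  rw [smul_del_apply_gen]
  split_ifs with h
  · exact h ▸ hf
  · exact zero_mem _

theorem del_mem_borelFull (q : Fin n) : ∂ q ∈ borelFull k p n := by
  have h := smul_del_mem_borelFull (subPoly_le_linPart k p n q (Subalgebra.one_mem _))
  rwa [one_smul] at h

theorem apply_mem_subPoly {D : Witt k p n} (hD : D ∈ borelFull k p n) {m : ℕ}
    {f : TruncPoly k p n} (hf : f ∈ subPoly k p n m) : D f ∈ subPoly k p n m := by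
  rw [mem_borelFull_iff] at hD
  induction hf using Algebra.adjoin_induction with
  | mem x hx =>
    obtain ⟨l, hl, rfl⟩ := hx
    exact linPart_le k p n l m hl (hD l)
  | algebraMap r => rw [Derivation.map_algebraMap]; exact zero_mem _
  | add x y _ _ hx hy => rw [map_add]; exact add_mem hx hy
  | mul x y hx' hy' hx hy =>
    rw [Derivation.leibniz]
    exact add_mem (mul_mem hx' hy) (mul_mem hy' hx)

theorem apply_mem_linPart {D : Witt k p n} (hD : D ∈ borelFull k p n) {q : Fin n}
    {f : TruncPoly k p n} (hf : f ∈ linPart k p n q) : D f ∈ linPart k p n q := by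
  induction hf using Submodule.mul_induction_on' with
  | mem_mul_mem a ha b hb =>
    obtain ⟨c, hc, d, hd, rfl⟩ := Submodule.mem_sup.1 ha
    obtain ⟨c, rfl⟩ := Submodule.mem_span_singleton.1 hc
    obtain ⟨d, rfl⟩ := Submodule.mem_span_singleton.1 hd
    have h1 : c • 1 + d • 𝐱 q ∈ linPart k p n q :=
      add_mem (Submodule.smul_mem _ _ (subPoly_le_linPart k p n q (Subalgebra.one_mem _)))
        (Submodule.smul_mem _ _ (gen_mem_linPart k p n q))
    have h2 : D (c • 1 + d • 𝐱 q) ∈ linPart k p n q := by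
      simpa using Submodule.smul_mem _ d (mem_borelFull_iff.1 hD q)
    rw [Derivation.leibniz]
    refine add_mem (mul_mem_linPart h1 (apply_mem_subPoly hD hb)) ?_
    rw [smul_eq_mul, mul_comm]
    exact mul_mem_linPart h2 hb
  | add x _ y _ hx hy => rw [map_add]; exact add_mem hx hy

end Borel

/-! ### Which conjugations stabilize the Borel subalgebra -/

section Stabilizer

theorem conj_symm_apply (φ : AutA k p n) (D : Witt k p n) (f : TruncPoly k p n) :
    conj k p n φ D (φ f) = φ (D f) := by
  rw [conj_apply, φ.symm_apply_apply]

theorem conj_smul (φ : AutA k p n) (f : TruncPoly k p n) (D : Witt k p n) :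
    conj k p n φ (f • D) = φ f • conj k p n φ D := by
  ext g
  rw [Derivation.smul_apply, conj_apply, conj_apply, Derivation.smul_apply, smul_eq_mul,
    smul_eq_mul, map_mul]

theorem autA_ext_gen {φ ψ : AutA k p n} (h : ∀ i, φ (𝐱 i) = ψ (𝐱 i)) : φ = ψ := by
  have : (φ : TruncPoly k p n →ₐ[k] TruncPoly k p n) = ψ := algHom_ext_gen h
  ext f
  exact DFunLike.congr_fun this f

theorem triangular_apply_mem_linPart [Fact p.Prime] {φ : AutA k p n} (hφ : φ ∈ triangular k p n) (q : Fin n) :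
    φ (𝐱 q) ∈ linPart k p n q := by
  have := add_mem (hφ q) (gen_mem_linPart k p n q)
  rwa [sub_add_cancel] at this

theorem triangular_le_flagIsotropy [Fact p.Prime] : triangular k p n ≤ flagIsotropy k p n := by
  intro φ hφ m _ _
  refine le_antisymm ?_ fun f hf => ?_
  · rintro _ ⟨f, hf, rfl⟩
    exact subPoly_stable k p n hφ m f hf
  · exact ⟨φ.symm f, subPoly_stable k p n (φ := φ⁻¹) (inv_mem hφ) m f hf, φ.apply_symm_apply f⟩

variable [CharP k p]

/-- If conjugation by `φ` is trivial, semilinearity gives `x_i ∂_i = φ(x_i) ∂_i`; evaluation at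
`x_i` yields `φ(x_i) = x_i`. -/
theorem conj_injective : Function.Injective (conj k p n) := by
  refine (injective_iff_map_eq_one _).2 fun φ hφ => autA_ext_gen fun i => ?_
  have h1 : ∀ D, conj k p n φ D = D := fun D => by rw [hφ]; rfl
  have h3 := h1 (𝐱 i • ∂ i)
  rw [conj_smul, h1] at h3
  simpa [del_gen] using Derivation.congr_fun h3 (𝐱 i)

/-- A subspace of `A(n)` stable under the full-varied Borel subalgebra is comparable with each
`(k + k x_q) k[x_1, …, x_{q-1}]`. -/
theorem le_of_borelFull_stable {M : Submodule k (TruncPoly k p n)}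
    (hM : ∀ D ∈ borelFull k p n, ∀ f ∈ M, D f ∈ M) (q : Fin n) :
    M ≤ linPart k p n q ∨ linPart k p n q ≤ M := by
  by_cases h : M ≤ linPart k p n q
  · exact Or.inl h
  right
  obtain ⟨f, hf, hfq⟩ := SetLike.not_le_iff_exists.1 h
  -- An operator `T` commuting with all partials has `T(M)` stable under them, so `T(M)` contains
  -- `1` once it is nonzero. Below, `T` is `∂_q²` or some `∂_r` with `r > q`, whichever detects `f ∉
  -- linPart q`. Applying `a ∂_q` to `∂_q g`, respectively `a ∂_r` to `g`, then produces any `a ∈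
  -- linPart q`.
  have key : ∀ T : TruncPoly k p n →ₗ[k] TruncPoly k p n, (∀ i g, ∂ i (T g) = T (∂ i g)) →
      T f ≠ 0 → ∃ g ∈ M, T g = 1 := by
    intro T hT h0
    have := one_mem_of_del_stable (V := M.map T) ?_ (Submodule.mem_map_of_mem hf) h0
    · simpa using this
    · rintro i _ ⟨g, hg, rfl⟩
      rw [hT]
      exact Submodule.mem_map_of_mem (hM _ (del_mem_borelFull i) g hg)
  by_cases h1 : ∀ i, q < i → ∂ i f = 0
  · have h2 : ∂ q (∂ q f) ≠ 0 := fun h2 => hfq (mem_linPart_iff.2 ⟨h1, h2⟩)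
    let T : TruncPoly k p n →ₗ[k] TruncPoly k p n := (∂ q).toLinearMap
    obtain ⟨g, hg, hg1⟩ := key (T ∘ₗ T) (fun i g => by
      change ∂ i (∂ q (∂ q g)) = ∂ q (∂ q (∂ i g))
      rw [del_comm i q, del_comm i q]) h2
    intro a ha
    have := hM _ (smul_del_mem_borelFull ha) _ (hM _ (del_mem_borelFull q) g hg)
    change ∂ q (∂ q g) = 1 at hg1
    rwa [Derivation.smul_apply, hg1, smul_eq_mul, mul_one] at this
  · push Not at h1
    obtain ⟨r, hr, h2⟩ := h1
    obtain ⟨g, hg, hg1⟩ := key (∂ r).toLinearMap (fun i g => del_comm i r g) h2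
    intro a ha
    have := hM _ (smul_del_mem_borelFull
      (subPoly_le_linPart k p n r (linPart_le k p n q r hr ha))) g hg
    change ∂ r g = 1 at hg1
    rwa [Derivation.smul_apply, hg1, smul_eq_mul, mul_one] at this

variable [Fact p.Prime]

theorem conj_mem_borelFull {φ : AutA k p n} (hφ : φ ∈ triangular k p n) {D : Witt k p n}
    (hD : D ∈ borelFull k p n) : conj k p n φ D ∈ borelFull k p n := by
  refine mem_borelFull_iff.2 fun q => ?_
  rw [conj_apply]
  exact linPart_stable k p n hφ q _ (apply_mem_linPart hD
    (triangular_apply_mem_linPart (inv_mem hφ) q))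

theorem conj_mem_Bgen {φ : AutA k p n} (hφ : φ ∈ triangular k p n) :
    conj k p n φ ∈ Bgen k p n := by
  have := finite_witt k p n
  refine Submodule.eq_of_le_of_finrank_eq ?_
    (LinearEquiv.finrank_map_eq (conj k p n φ).toLinearEquiv (borelFull k p n))
  rintro _ ⟨D, hD, rfl⟩
  exact conj_mem_borelFull hφ hD

/-- The image of `linPart q` under `φ` is again stable under `borelFull`, hence comparable with
`linPart q`; having the same finite dimension, the two coincide. -/
theorem mem_triangular_of_conj_mem_Bgen {φ : AutA k p n} (h : conj k p n φ ∈ Bgen k p n) :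
    φ ∈ triangular k p n := by
  have := finite_truncPoly k p n
  intro q
  refine sub_mem ?_ (gen_mem_linPart k p n q)
  have hstab : ∀ D ∈ borelFull k p n, ∀ f ∈ (linPart k p n q).map φ.toLinearMap,
      D f ∈ (linPart k p n q).map φ.toLinearMap := by
    rintro D hD _ ⟨f, hf, rfl⟩
    have h' : (borelFull k p n).map (conj k p n φ : Witt k p n →ₗ[k] Witt k p n) =
      borelFull k p n := h
    rw [← h'] at hD
    obtain ⟨E, hE, rfl⟩ := hD
    exact ⟨E f, apply_mem_linPart hE hf, (conj_symm_apply φ E f).symm⟩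
  have hrank : Module.finrank k ((linPart k p n q).map φ.toLinearMap) =
      Module.finrank k (linPart k p n q) :=
    LinearEquiv.finrank_map_eq φ.toLinearEquiv _
  have heq : (linPart k p n q).map φ.toLinearMap = linPart k p n q := by
    rcases le_of_borelFull_stable hstab q with hle | hle
    · exact Submodule.eq_of_le_of_finrank_eq hle hrank
    · exact (Submodule.eq_of_le_of_finrank_eq hle hrank.symm).symm
  exact heq ▸ Submodule.mem_map_of_mem (gen_mem_linPart k p n q)

end Stabilizer

/-! ### Two ideals of the Borel subalgebra preserved by its stabilizer -/

section Ideals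

variable [CharP k p]

/-- The derivations `a ∂_t` with `∂_t a = 0`. -/
def constIdeal (k : Type*) [Field k] (p : ℕ) {n : ℕ} [CharP k p] (t : Fin n) :
    Submodule k (Witt k p n) where
  carrier := {D | (∀ q, q ≠ t → D (gen k p n q) = 0) ∧ del k p n t (D (gen k p n t)) = 0}
  add_mem' {D E} hD hE := ⟨fun q hq => by
    rw [Derivation.add_apply, hD.1 q hq, hE.1 q hq, add_zero], by
    rw [Derivation.add_apply, map_add, hD.2, hE.2, add_zero]⟩
  zero_mem' := ⟨fun _ _ => rfl, map_zero _⟩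
  smul_mem' c D hD := ⟨fun q hq => by rw [Derivation.smul_apply, hD.1 q hq, smul_zero], by
    rw [Derivation.smul_apply, Derivation.map_smul, hD.2, smul_zero]⟩

/-- The derivations `(a x_t + b) ∂_t` with `∂_t a = ∂_t b = 0`. -/
def affineIdeal (k : Type*) [Field k] (p : ℕ) {n : ℕ} [CharP k p] (t : Fin n) :
    Submodule k (Witt k p n) where
  carrier := {D | (∀ q, q ≠ t → D (gen k p n q) = 0) ∧
    del k p n t (del k p n t (D (gen k p n t))) = 0}
  add_mem' {D E} hD hE := ⟨fun q hq => by
    rw [Derivation.add_apply, hD.1 q hq, hE.1 q hq, add_zero], by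
    rw [Derivation.add_apply, map_add, map_add, hD.2, hE.2, add_zero]⟩
  zero_mem' := ⟨fun _ _ => rfl, by rw [Derivation.zero_apply, map_zero, map_zero]⟩
  smul_mem' c D hD := ⟨fun q hq => by rw [Derivation.smul_apply, hD.1 q hq, smul_zero], by
    rw [Derivation.smul_apply, Derivation.map_smul, Derivation.map_smul, hD.2, smul_zero]⟩

variable {t : Fin n}

theorem constIdeal_le_affineIdeal : constIdeal k p t ≤ affineIdeal k p t := fun D hD =>
  ⟨hD.1, by rw [hD.2, map_zero]⟩

theorem eq_smul_del {D : Witt k p n} (hD : ∀ q, q ≠ t → D (𝐱 q) = 0) : D = D (𝐱 t) • ∂ t :=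
  witt_ext_gen fun q => by
    rw [smul_del_apply_gen]
    split_ifs with h
    · rw [h]
    · exact hD q (Ne.symm h)

theorem smul_del_mem_constIdeal {a : TruncPoly k p n} (ha : ∂ t a = 0) :
    a • ∂ t ∈ constIdeal k p t :=
  ⟨fun q hq => by rw [smul_del_apply_gen, if_neg hq.symm], by
    rw [smul_del_apply_gen, if_pos rfl, ha]⟩

theorem smul_del_mem_affineIdeal {a : TruncPoly k p n} (ha : ∂ t (∂ t a) = 0) :
    a • ∂ t ∈ affineIdeal k p t :=
  ⟨fun q hq => by rw [smul_del_apply_gen, if_neg hq.symm], by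
    rw [smul_del_apply_gen, if_pos rfl, ha]⟩

theorem affineIdeal_le_borelFull (ht : ∀ q, q ≤ t) : affineIdeal k p t ≤ borelFull k p n := by
  intro D hD
  rw [eq_smul_del hD.1]
  exact smul_del_mem_borelFull (mem_linPart_iff.2
    ⟨fun i hi => absurd (ht i) (not_le.2 hi), hD.2⟩)

theorem del_apply_gen_of_mem_borelFull (ht : ∀ q, q ≤ t) {D : Witt k p n}
    (hD : D ∈ borelFull k p n) : (∀ q, q ≠ t → ∂ t (D (𝐱 q)) = 0) ∧ ∂ t (∂ t (D (𝐱 t))) = 0 := by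
  rw [mem_borelFull_iff] at hD
  exact ⟨fun q hq => (mem_linPart_iff.1 (hD q)).1 t (lt_of_le_of_ne (ht q) hq),
    (mem_linPart_iff.1 (hD t)).2⟩

theorem del_apply {D : Witt k p n} (hD : ∀ q, q ≠ t → ∂ t (D (𝐱 q)) = 0) (f : TruncPoly k p n) :
    ∂ t (D f) = D (∂ t f) + ∂ t (D (𝐱 t)) * ∂ t f := by
  have h : ⁅∂ t, D⁆ = ∂ t (D (𝐱 t)) • ∂ t := by
    rw [eq_smul_del (t := t) (D := ⁅∂ t, D⁆)]
    · simp [Derivation.commutator_apply, del_gen]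
    · intro q hq
      simp [Derivation.commutator_apply, del_gen, hq.symm, hD q hq]
  have := Derivation.congr_fun h f
  rw [Derivation.commutator_apply, Derivation.smul_apply, smul_eq_mul] at this
  rw [← this, add_sub_cancel]

theorem lie_apply_gen {D E : Witt k p n} (hE : ∀ q, q ≠ t → E (𝐱 q) = 0) :
    ⁅D, E⁆ (𝐱 t) = D (E (𝐱 t)) - E (𝐱 t) * ∂ t (D (𝐱 t)) := by
  rw [Derivation.commutator_apply]
  congr 1
  conv_lhs => rw [eq_smul_del hE]
  rfl

theorem lie_apply_gen_ne {D E : Witt k p n} (hD : ∀ q, q ≠ t → ∂ t (D (𝐱 q)) = 0)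
    (hE : ∀ q, q ≠ t → E (𝐱 q) = 0) {q : Fin n} (hq : q ≠ t) : ⁅D, E⁆ (𝐱 q) = 0 := by
  rw [Derivation.commutator_apply, hE q hq, map_zero, eq_smul_del hE, Derivation.smul_apply,
    hD q hq, smul_zero, sub_zero]

/-- Call `∂_t (E x_t)` the slope of `E`. The bracket with `D` acts on slopes simply by applying `D`,
which makes `constIdeal` and `affineIdeal` ideals and drives the maximality arguments. -/
theorem del_lie_apply_gen {D E : Witt k p n} (hD : ∀ q, q ≠ t → ∂ t (D (𝐱 q)) = 0)
    (hD2 : ∂ t (∂ t (D (𝐱 t))) = 0) (hE : ∀ q, q ≠ t → E (𝐱 q) = 0) :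
    ∂ t (⁅D, E⁆ (𝐱 t)) = D (∂ t (E (𝐱 t))) := by
  rw [lie_apply_gen hE, map_sub, del_apply hD, Derivation.leibniz, hD2]
  simp

theorem lie_mem_constIdeal {D E : Witt k p n} (hD : ∀ q, q ≠ t → ∂ t (D (𝐱 q)) = 0)
    (hD2 : ∂ t (∂ t (D (𝐱 t))) = 0) (hE : E ∈ constIdeal k p t) : ⁅D, E⁆ ∈ constIdeal k p t :=
  ⟨fun _ hq => lie_apply_gen_ne hD hE.1 hq, by rw [del_lie_apply_gen hD hD2 hE.1, hE.2, map_zero]⟩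

theorem lie_mem_affineIdeal {D E : Witt k p n} (hD : ∀ q, q ≠ t → ∂ t (D (𝐱 q)) = 0)
    (hD2 : ∂ t (∂ t (D (𝐱 t))) = 0) (hE : E ∈ affineIdeal k p t) : ⁅D, E⁆ ∈ affineIdeal k p t :=
  ⟨fun _ hq => lie_apply_gen_ne hD hE.1 hq, by
    rw [del_lie_apply_gen hD hD2 hE.1, del_apply hD, hE.2, map_zero, mul_zero, add_zero]⟩

theorem lie_affineIdeal_constIdeal {D E : Witt k p n} (hD : D ∈ affineIdeal k p t)
    (hE : E ∈ constIdeal k p t) : ⁅D, E⁆ = -(∂ t (D (𝐱 t)) * E (𝐱 t)) • ∂ t := by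
  have hD1 : ∀ q, q ≠ t → ∂ t (D (𝐱 q)) = 0 := fun q hq => by rw [hD.1 q hq, map_zero]
  have h := lie_apply_gen (D := D) hE.1
  rw [eq_smul_del (t := t) (D := ⁅D, E⁆) fun q hq => lie_apply_gen_ne hD1 hE.1 hq, h]
  congr 1
  conv_lhs => rw [eq_smul_del hD.1]
  simp [hE.2, mul_comm, del_gen]

theorem lie_affineIdeal {D E : Witt k p n} (hD : D ∈ affineIdeal k p t)
    (hE : E ∈ affineIdeal k p t) : ⁅D, E⁆ ∈ constIdeal k p t := by
  have hD1 : ∀ q, q ≠ t → ∂ t (D (𝐱 q)) = 0 := fun q hq => by rw [hD.1 q hq, map_zero]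
  refine ⟨fun q hq => lie_apply_gen_ne hD1 hE.1 hq, ?_⟩
  rw [del_lie_apply_gen hD1 hD.2 hE.1, eq_smul_del hD.1, Derivation.smul_apply, hE.2, smul_zero]

section Maximality

variable [Fact p.Prime] (ht : ∀ q, q ≤ t) {K : Submodule k (Witt k p n)}
  (hKb : K ≤ borelFull k p n) (hideal : ∀ D ∈ borelFull k p n, ∀ E ∈ K, ⁅D, E⁆ ∈ K)

-- A nonzero slope can be differentiated down to `1` inside `K`. An `E ∈ K` of slope `1` satisfies
-- `[∂_t, E] = ∂_t`, so `∂_t ∈ K` fails to commute with `E`.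
include ht hideal in
theorem mem_constIdeal_of_abelian_aux (habel : ∀ D ∈ K, ∀ E ∈ K, ⁅D, E⁆ = 0) {D : Witt k p n}
    (hD : D ∈ K) (hDI : D ∈ affineIdeal k p t) : D ∈ constIdeal k p t := by
  refine ⟨hDI.1, ?_⟩
  by_contra h0
  let T : Witt k p n →ₗ[k] TruncPoly k p n :=
    { toFun := fun E => ∂ t (E (𝐱 t))
      map_add' := fun E F => by rw [Derivation.add_apply, map_add]
      map_smul' := fun c E => by rw [Derivation.smul_apply, Derivation.map_smul, RingHom.id_apply] }
  have h1 := one_mem_of_del_stable (V := (K ⊓ affineIdeal k p t).map T) ?_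
    (Submodule.mem_map_of_mem ⟨hD, hDI⟩) h0
  · obtain ⟨E, ⟨hEK, hEI⟩, hE⟩ := h1
    change ∂ t (E (𝐱 t)) = 1 at hE
    have h2 : ⁅∂ t, E⁆ = ∂ t := by
      have hd := del_apply_gen_of_mem_borelFull ht (del_mem_borelFull (k := k) (p := p) t)
      rw [eq_smul_del (t := t) (D := ⁅∂ t, E⁆) fun q hq => lie_apply_gen_ne hd.1 hEI.1 hq,
        lie_apply_gen hEI.1, hE, del_gen, if_pos rfl, Derivation.map_one_eq_zero, mul_zero,
        sub_zero, one_smul]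
    have h3 := habel _ (hideal _ (del_mem_borelFull t) E hEK) E hEK
    rw [h2, h2] at h3
    have := Derivation.congr_fun h3 (𝐱 t)
    rw [del_gen, if_pos rfl] at this
    exact one_ne_zero this
  · rintro i _ ⟨E, ⟨hEK, hEI⟩, rfl⟩
    have hd := del_apply_gen_of_mem_borelFull ht (del_mem_borelFull (k := k) (p := p) i)
    refine ⟨⁅∂ i, E⁆, ⟨hideal _ (del_mem_borelFull i) E hEK,
      lie_mem_affineIdeal hd.1 hd.2 hEI⟩, ?_⟩
    exact del_lie_apply_gen hd.1 hd.2 hEI.1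

include ht hKb hideal in
theorem le_constIdeal_of_abelian (habel : ∀ D ∈ K, ∀ E ∈ K, ⁅D, E⁆ = 0) :
    K ≤ constIdeal k p t := by
  intro D hD
  have hDb := del_apply_gen_of_mem_borelFull ht (hKb hD)
  refine mem_constIdeal_of_abelian_aux ht hideal habel hD ⟨fun q hq => ?_, hDb.2⟩
  -- The bracket of `D` with this element lies in `K` and in `affineIdeal`, with slope `D x_q`; the
  -- preceding lemma makes that slope vanish.
  have hE : (𝐱 q * 𝐱 t) • ∂ t ∈ affineIdeal k p t :=
    smul_del_mem_affineIdeal (by simp [del_gen, hq.symm])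
  have h1 : ⁅D, (𝐱 q * 𝐱 t) • ∂ t⁆ ∈ K := by
    rw [← lie_skew]
    exact neg_mem (hideal _ (affineIdeal_le_borelFull ht hE) D hD)
  have h2 := (mem_constIdeal_of_abelian_aux ht hideal habel h1
    (lie_mem_affineIdeal hDb.1 hDb.2 hE)).2
  rw [del_lie_apply_gen hDb.1 hDb.2 hE.1] at h2
  simpa [del_gen, hq.symm] using h2

include ht hKb hideal in
theorem le_affineIdeal_of_lie_mem (hp : p ≠ 2)
    (habel : ∀ D ∈ K, ∀ E ∈ K, ⁅D, E⁆ ∈ constIdeal k p t) : K ≤ affineIdeal k p t := by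
  intro D hD
  refine ⟨fun q hq => ?_, (del_apply_gen_of_mem_borelFull ht (hKb hD)).2⟩
  by_contra h0
  let T : Witt k p n →ₗ[k] TruncPoly k p n :=
    { toFun := fun E => E (𝐱 q)
      map_add' := fun E F => rfl
      map_smul' := fun c E => rfl }
  have h1 := one_mem_of_del_stable (V := K.map T) ?_ (Submodule.mem_map_of_mem hD) h0
  · obtain ⟨D, hD, hDq⟩ := h1
    change D (𝐱 q) = 1 at hDq
    have hDb := del_apply_gen_of_mem_borelFull ht (hKb hD)
    -- With `D x_q = 1`, bracketing twice with `D` gives slope `D²(x_q²) = 2`. This must be `0`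
    -- because `[K, K] ⊆ constIdeal`, contradicting `p ≠ 2`.
    have hE : (𝐱 q * 𝐱 q * 𝐱 t) • ∂ t ∈ affineIdeal k p t :=
      smul_del_mem_affineIdeal (by simp [del_gen, hq.symm])
    have h1 : ⁅D, (𝐱 q * 𝐱 q * 𝐱 t) • ∂ t⁆ ∈ K := by
      rw [← lie_skew]
      exact neg_mem (hideal _ (affineIdeal_le_borelFull ht hE) D hD)
    have h2 := (habel D hD _ h1).2
    rw [del_lie_apply_gen hDb.1 hDb.2 (lie_mem_affineIdeal hDb.1 hDb.2 hE).1,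
      del_lie_apply_gen hDb.1 hDb.2 hE.1] at h2
    have h3 : (2 : TruncPoly k p n) = 0 := by
      simpa [del_gen, hq.symm, hDq, one_add_one_eq_two] using h2
    have := charP_truncPoly (k := k) (p := p) (n := n)
    have h4 := (CharP.cast_eq_zero_iff (TruncPoly k p n) p 2).1 (by exact_mod_cast h3)
    exact hp ((Nat.prime_dvd_prime_iff_eq Fact.out Nat.prime_two).1 h4)
  · rintro i _ ⟨E, hEK, rfl⟩
    refine ⟨⁅∂ i, E⁆, hideal _ (del_mem_borelFull i) E hEK, ?_⟩
    change ⁅∂ i, E⁆ (𝐱 q) = ∂ i (E (𝐱 q))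
    rw [Derivation.commutator_apply, del_gen]
    split_ifs <;> simp

end Maximality

section Invariance

variable (ht : ∀ q, q ≤ t) {g : AutW k p n} (hg : g ∈ Bgen k p n)

include hg in
theorem apply_mem_borelFull {D : Witt k p n} (hD : D ∈ borelFull k p n) :
    g D ∈ borelFull k p n := by
  have h : (borelFull k p n).map (g : Witt k p n →ₗ[k] Witt k p n) = borelFull k p n := hg
  rw [← h]
  exact Submodule.mem_map_of_mem hD

variable [Fact p.Prime]

-- The image under `g` of this abelian ideal of `borelFull` is again an abelian ideal of
-- `borelFull`, so maximality applies.
include ht hg in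
theorem apply_mem_constIdeal {D : Witt k p n} (hD : D ∈ constIdeal k p t) :
    g D ∈ constIdeal k p t := by
  have hle := constIdeal_le_affineIdeal.trans (affineIdeal_le_borelFull (k := k) (p := p) ht)
  refine le_constIdeal_of_abelian (K := (constIdeal k p t).map
    (g : Witt k p n →ₗ[k] Witt k p n)) ht ?_ ?_ ?_ (Submodule.mem_map_of_mem hD)
  · rintro _ ⟨E, hE, rfl⟩
    exact apply_mem_borelFull hg (hle hE)
  · rintro F hF _ ⟨E, hE, rfl⟩
    have hF' := del_apply_gen_of_mem_borelFull ht (apply_mem_borelFull (inv_mem hg) hF)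
    refine ⟨⁅g⁻¹ F, E⁆, lie_mem_constIdeal hF'.1 hF'.2 hE, ?_⟩
    change g ⁅g.symm F, E⁆ = ⁅F, g E⁆
    rw [LieEquiv.map_lie, g.apply_symm_apply]
  · rintro _ ⟨E, hE, rfl⟩ _ ⟨F, hF, rfl⟩
    change ⁅g E, g F⁆ = 0
    rw [← LieEquiv.map_lie, lie_affineIdeal_constIdeal (constIdeal_le_affineIdeal hE) hF, hE.2,
      zero_mul, neg_zero, zero_smul, map_zero]

include ht hg in
theorem apply_mem_affineIdeal (hp : p ≠ 2) {D : Witt k p n} (hD : D ∈ affineIdeal k p t) :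
    g D ∈ affineIdeal k p t := by
  refine le_affineIdeal_of_lie_mem (K := (affineIdeal k p t).map
    (g : Witt k p n →ₗ[k] Witt k p n)) ht ?_ ?_ hp ?_ (Submodule.mem_map_of_mem hD)
  · rintro _ ⟨E, hE, rfl⟩
    exact apply_mem_borelFull hg (affineIdeal_le_borelFull ht hE)
  · rintro F hF _ ⟨E, hE, rfl⟩
    have hF' := del_apply_gen_of_mem_borelFull ht (apply_mem_borelFull (inv_mem hg) hF)
    refine ⟨⁅g⁻¹ F, E⁆, lie_mem_affineIdeal hF'.1 hF'.2 hE, ?_⟩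
    change g ⁅g.symm F, E⁆ = ⁅F, g E⁆
    rw [LieEquiv.map_lie, g.apply_symm_apply]
  · rintro _ ⟨E, hE, rfl⟩ _ ⟨F, hF, rfl⟩
    change ⁅g E, g F⁆ ∈ _
    rw [← LieEquiv.map_lie]
    exact apply_mem_constIdeal ht hg (lie_affineIdeal hE hF)

end Invariance

end Ideals

/-! ### Building an automorphism of `A(n)` from the action on the two ideals -/

section Realization

theorem conj_eq_of_apply_gen {φ : AutA k p n} {D E : Witt k p n}
    (h : ∀ i, E (φ (𝐱 i)) = φ (D (𝐱 i))) : conj k p n φ D = E := by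
  have h1 : D = conj k p n φ⁻¹ E := witt_ext_gen fun i => by
    change _ = φ.symm (E (φ (𝐱 i)))
    rw [h, φ.symm_apply_apply]
  rw [h1, map_inv]
  exact (conj k p n φ).apply_symm_apply E

variable [Fact p.Prime]

theorem bijective_of_gen_mem_range {f : TruncPoly k p n →ₐ[k] TruncPoly k p n}
    (h : ∀ i, 𝐱 i ∈ f.range) : Function.Bijective f := by
  have := finite_truncPoly k p n
  have hs : Function.Surjective f := by
    rw [← AlgHom.range_eq_top, eq_top_iff, ← adjoin_gen]
    refine Algebra.adjoin_le ?_
    rintro _ ⟨i, rfl⟩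
    exact h i
  exact ⟨LinearMap.injective_iff_surjective (f := f.toLinearMap).2 hs, hs⟩

variable [CharP k p] {t : Fin n} {g : AutW k p n}

/-- An automorphism of `W(n)` stabilizing `A(n-1) ∂_n` and `A(n-1) (k + k x_n) ∂_n` agrees on these
spaces with an automorphism induced from `A(n)`, up to a translation by a constant. -/
theorem exists_conj_eq_on_affineIdeal (ht : ∀ q, q ≤ t) (hp : p ≠ 2) (hg : g ∈ Bgen k p n) :
    ∃ (η : AutA k p n) (c : k), (∀ a, ∂ t a = 0 → g (a • ∂ t) = conj k p n η (a • ∂ t)) ∧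
      g (𝐱 t • ∂ t) = conj k p n η ((𝐱 t + algebraMap k _ c) • ∂ t) := by
  have hA : ∀ {f}, f ∈ subPoly k p n t ↔ ∂ t f = 0 := fun {f} => by
    rw [mem_subPoly_iff]
    exact ⟨fun h => h t le_rfl, fun h i hi => (le_antisymm (ht i) hi) ▸ h⟩
  -- `ψ` records the action on `constIdeal`, and `φ` below the action on slopes, both for `a` with
  -- `∂_t a = 0`.
  set ψ : TruncPoly k p n → TruncPoly k p n := fun a => g (a • ∂ t) (𝐱 t) with hψ
  have hgψ : ∀ a, ∂ t a = 0 → g (a • ∂ t) = ψ a • ∂ t := fun a ha =>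
    eq_smul_del (apply_mem_constIdeal ht hg (smul_del_mem_constIdeal ha)).1
  have hψ0 : ∀ a, ∂ t a = 0 → ∂ t (ψ a) = 0 := fun a ha =>
    (apply_mem_constIdeal ht hg (smul_del_mem_constIdeal ha)).2
  have hψs : ∀ b, ∂ t b = 0 → ∃ a, ∂ t a = 0 ∧ ψ a = b := fun b hb => by
    have h1 := apply_mem_constIdeal ht (inv_mem hg) (smul_del_mem_constIdeal hb)
    refine ⟨_, h1.2, ?_⟩
    rw [hψ]
    change g (_ • ∂ t) (𝐱 t) = b
    rw [← eq_smul_del h1.1]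
    change g (g.symm (b • ∂ t)) (𝐱 t) = b
    rw [g.apply_symm_apply, smul_del_apply_gen, if_pos rfl]
  have haff : ∀ a, ∂ t a = 0 → (a * 𝐱 t) • ∂ t ∈ affineIdeal k p t := fun a ha =>
    smul_del_mem_affineIdeal (by simp [ha, del_gen])
  set φ : TruncPoly k p n →ₗ[k] TruncPoly k p n :=
    { toFun := fun a => ∂ t (g ((a * 𝐱 t) • ∂ t) (𝐱 t))
      map_add' := fun a b => by
        rw [add_mul, add_smul, map_add, Derivation.add_apply, map_add]
      map_smul' := fun c a => by
        have h : g (c • (a * 𝐱 t) • ∂ t) = c • g ((a * 𝐱 t) • ∂ t) :=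
          map_smul g.toLinearEquiv c _
        rw [smul_mul_assoc, smul_assoc, h, Derivation.smul_apply, Derivation.map_smul,
          RingHom.id_apply] } with hφ
  -- Apply `g` to `[a x_t ∂_t, f ∂_t] = -(a f) ∂_t`. Since `ψ 1` will turn out to be a unit, this
  -- relation makes `φ` multiplicative.
  have hφψ : ∀ a f, ∂ t a = 0 → ∂ t f = 0 → ψ (a * f) = φ a * ψ f := by
    intro a f ha hf
    have h1 := lie_affineIdeal_constIdeal (haff a ha) (smul_del_mem_constIdeal hf)
    have h2 := congrArg g h1
    rw [LieEquiv.map_lie, lie_affineIdeal_constIdeal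
      (apply_mem_affineIdeal ht hg hp (haff a ha))
      (apply_mem_constIdeal ht hg (smul_del_mem_constIdeal hf))] at h2
    have h3 := Derivation.congr_fun h2 (𝐱 t)
    rw [smul_del_apply_gen, smul_del_apply_gen, if_pos rfl, if_pos rfl, neg_smul, map_neg,
      smul_del_apply_gen, if_pos rfl, Derivation.neg_apply, neg_inj] at h3
    have h4 : ∂ t (a * 𝐱 t) = a := by simp [ha, del_gen]
    rw [h4] at h3
    exact h3.symm
  have hφ0 : ∀ a, ∂ t a = 0 → ∂ t (φ a) = 0 := fun a ha =>
    (apply_mem_affineIdeal ht hg hp (haff a ha)).2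
  have h1 : ∂ t (1 : TruncPoly k p n) = 0 := Derivation.map_one_eq_zero _
  obtain ⟨a₀, ha₀, ha₀1⟩ := hψs 1 h1
  have hφ1 : ∀ a, ∂ t a = 0 → ψ a = φ a * ψ 1 := fun a ha => by
    rw [← hφψ a 1 ha h1, mul_one]
  set u := ψ 1 with hu
  set v := φ a₀ with hv
  have hvu : v * u = 1 := by rw [← ha₀1, hφ1 a₀ ha₀]
  have hinj : ∀ {a b : TruncPoly k p n}, a * u = b * u → a = b := fun {a b} h => by
    rw [← mul_one a, ← mul_one b, ← hvu, mul_comm v, ← mul_assoc, h, mul_assoc]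
  have hφone : φ 1 = 1 := hinj (by rw [← hφ1 1 h1, one_mul])
  have hφmul : ∀ a b, ∂ t a = 0 → ∂ t b = 0 → φ (a * b) = φ a * φ b := fun a b ha hb =>
    hinj (by rw [← hφ1 _ (by simp [ha, hb]), hφψ a b ha hb, hφ1 b hb, mul_assoc])
  let φA : subPoly k p n t →ₐ[k] TruncPoly k p n :=
    AlgHom.ofLinearMap (φ ∘ₗ (Subalgebra.toSubmodule (subPoly k p n t)).subtype) hφone
      fun a b => hφmul a b (hA.1 a.2) (hA.1 b.2)
  have hφpow : ∀ a, ∂ t a = 0 → a ^ p = 0 → φ a ^ p = 0 := fun a ha hap => by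
    change φA ⟨a, hA.2 ha⟩ ^ p = 0
    rw [← map_pow]
    change φ (a ^ p) = 0
    rw [hap, map_zero]
  have hx : 𝐱 t • ∂ t ∈ affineIdeal k p t := by simpa using haff 1 h1
  set e := g (𝐱 t • ∂ t) (𝐱 t) with he
  have hge : g (𝐱 t • ∂ t) = e • ∂ t := eq_smul_del (apply_mem_affineIdeal ht hg hp hx).1
  have hde : ∂ t e = 1 := by
    rw [← hφone]
    change _ = ∂ t (g ((1 * 𝐱 t) • ∂ t) (𝐱 t))
    rw [one_mul]
  have hauguv : aug v * aug u = 1 := by rw [← map_mul, hvu, map_one]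
  have haugu : aug u ≠ 0 := right_ne_zero_of_mul_eq_one hauguv
  -- The constant `c` is chosen to remove the constant term of `e - c u`, so that `w^p = 0` and `v
  -- w` is an admissible image of `x_t`.
  set c : k := aug e / aug u with hc
  set w := e - c • u with hw
  have hdu : ∂ t u = 0 := hψ0 1 h1
  have hdv : ∂ t v = 0 := hφ0 a₀ ha₀
  have hdw : ∂ t w = 1 := by rw [hw, map_sub, Derivation.map_smul, hde, hdu, smul_zero, sub_zero]
  have haugw : aug w = 0 := by
    rw [hw, map_sub, map_smul, smul_eq_mul, hc, div_mul_cancel₀ _ haugu, sub_self]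
  -- The image of `x_t` is forced: `η` must carry `∂_t` to `u ∂_t`, and indeed `u ∂_t (v w) = u v =
  -- 1`. Moreover `v w + c = v e`, which matches `x_t + c` with `e ∂_t`.
  let y : Fin n → TruncPoly k p n := fun q => if q = t then v * w else φ (𝐱 q)
  have hdq : ∀ q, q ≠ t → ∂ t (𝐱 q) = 0 := fun q hq => by rw [del_gen, if_neg hq.symm]
  have hy : ∀ q, y q ^ p = 0 := fun q => by
    by_cases hq : q = t
    · simp only [y, if_pos hq]
      rw [mul_pow, (pow_eq_zero_iff_aug w).2 haugw, mul_zero]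
    · simp only [y, if_neg hq]
      exact hφpow _ (hdq q hq) (gen_pow k p n q)
  let η₀ : TruncPoly k p n →ₐ[k] TruncPoly k p n := liftHom y hy
  have hη₀t : η₀ (𝐱 t) = v * w := by rw [liftHom_gen]; exact if_pos rfl
  have hη₀q : ∀ q, q ≠ t → η₀ (𝐱 q) = φ (𝐱 q) := fun q hq => by
    rw [liftHom_gen]; exact if_neg hq
  have hη₀ : ∀ a, ∂ t a = 0 → η₀ a = φ a := by
    intro a ha
    rw [← hA] at ha
    induction ha using Algebra.adjoin_induction with
    | mem x hx =>
      obtain ⟨l, hl, rfl⟩ := hx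
      exact hη₀q l fun h => by rw [h] at hl; exact lt_irrefl _ hl
    | algebraMap r =>
      rw [AlgHom.commutes, Algebra.algebraMap_eq_smul_one, map_smul, hφone]
    | add x y _ _ hx hy => rw [map_add, map_add, hx, hy]
    | mul x y hx' hy' hx hy => rw [map_mul, hφmul x y (hA.1 hx') (hA.1 hy'), hx, hy]
  have hrange : ∀ b, ∂ t b = 0 → b ∈ η₀.range := fun b hb => by
    obtain ⟨a, ha, hab⟩ := hψs (b * u) (by simp [hb, hdu])
    refine ⟨a, ?_⟩
    change η₀ a = b
    rw [hη₀ a ha]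
    exact hinj (by rw [← hφ1 a ha, hab])
  have hbij : Function.Bijective η₀ := bijective_of_gen_mem_range fun q => by
    by_cases hq : q = t
    · subst hq
      have h2 : 𝐱 q = u * η₀ (𝐱 q) - (w - 𝐱 q) := by
        rw [hη₀t, ← mul_assoc, mul_comm u, hvu, one_mul, sub_sub_cancel]
      rw [h2]
      exact sub_mem (mul_mem (hrange u hdu) ⟨_, rfl⟩)
        (hrange _ (by rw [map_sub, hdw, del_gen, if_pos rfl, sub_self]))
    · exact hrange _ (hdq q hq)
  let η : AutA k p n := AlgEquiv.ofBijective η₀ hbij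
  have hηη : ∀ f, η f = η₀ f := fun f => rfl
  refine ⟨η, c, fun a ha => Eq.symm (conj_eq_of_apply_gen fun q => ?_),
    Eq.symm (conj_eq_of_apply_gen fun q => ?_)⟩
  · rw [hgψ a ha, Derivation.smul_apply, smul_eq_mul, smul_del_apply_gen, hηη, hηη]
    split_ifs with hq
    · subst hq
      rw [hη₀t, hη₀ a ha, Derivation.leibniz, hdw, hdv, smul_zero, add_zero, smul_eq_mul, mul_one,
        hφ1 a ha, mul_assoc, mul_comm u, hvu, mul_one]
    · rw [hη₀q q (Ne.symm hq), hφ0 _ (hdq q (Ne.symm hq)), mul_zero, map_zero]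
  · rw [hge, Derivation.smul_apply, smul_eq_mul, smul_del_apply_gen, hηη, hηη]
    split_ifs with hq
    · subst hq
      rw [map_add, AlgHom.commutes, hη₀t, Derivation.leibniz, hdw, hdv, smul_zero, add_zero,
        smul_eq_mul, mul_one, hw, mul_sub, mul_smul_comm, hvu, Algebra.algebraMap_eq_smul_one,
        sub_add_cancel, mul_comm]
    · rw [hη₀q q (Ne.symm hq), hφ0 _ (hdq q (Ne.symm hq)), mul_zero, map_zero]

end Realization

/-! ### Rigidity: automorphisms fixing `constIdeal` pointwise -/

section Rigidity

variable [CharP k p] {t : Fin n}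

theorem lie_smul_del (e f : TruncPoly k p n) (s q : Fin n) :
    ⁅e • ∂ s, f • ∂ q⁆ = (e * ∂ s f) • ∂ q - (f * ∂ q e) • ∂ s := by
  refine witt_ext_gen fun r => ?_
  rw [Derivation.commutator_apply, Derivation.sub_apply, smul_del_apply_gen, smul_del_apply_gen,
    smul_del_apply_gen, smul_del_apply_gen]
  split_ifs <;> simp

theorem lie_del_smul_del (f : TruncPoly k p n) (s q : Fin n) :
    ⁅∂ s, f • ∂ q⁆ = ∂ s f • ∂ q := by
  have h := lie_smul_del 1 f s q
  rwa [one_smul, one_mul, Derivation.map_one_eq_zero, mul_zero, zero_smul, sub_zero] at h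

theorem del_pow_mul {X a : TruncPoly k p n} (hX : ∂ t X = 1) (ha : ∂ t a = 0) (m : ℕ) :
    ∂ t (X ^ (m + 1) * a) = ((m + 1 : ℕ) : k) • (X ^ m * a) := by
  rw [Derivation.leibniz, ha, Derivation.leibniz_pow, hX, smul_zero, zero_add,
    Nat.add_sub_cancel, smul_eq_mul, smul_eq_mul, mul_one, ← Nat.cast_smul_eq_nsmul k,
    mul_smul_comm, mul_comm a]

/-- A derivation centralizing all `a ∂_t` with `∂_t a = 0` is itself of this form. -/
theorem mem_constIdeal_of_lie_eq_zero {Z : Witt k p n}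
    (h : ∀ a, ∂ t a = 0 → ⁅Z, a • ∂ t⁆ = 0) : Z ∈ constIdeal k p t := by
  have h1 : ∀ r, ∂ t (Z (𝐱 r)) = 0 := fun r => by
    have h2 := Derivation.congr_fun (h 1 (Derivation.map_one_eq_zero _)) (𝐱 r)
    rw [one_smul, Derivation.commutator_apply, del_gen, Derivation.zero_apply] at h2
    split_ifs at h2 <;> simpa using h2
  refine ⟨fun q hq => ?_, h1 t⟩
  have h2 := Derivation.congr_fun (h (𝐱 q) (by rw [del_gen, if_neg hq.symm])) (𝐱 t)
  simpa [Derivation.commutator_apply, del_gen, h1] using h2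

variable {g : AutW k p n} {c : k}

/-- Since `g` fixes `constIdeal`, `g D` acts on it as `D` does, hence as `E` does; the difference
centralizes `constIdeal` and therefore lies in it. -/
theorem apply_mem_constIdeal_sub (hJ : ∀ a : TruncPoly k p n, ∂ t a = 0 → g (a • ∂ t) = a • ∂ t) {D E : Witt k p n}
    (hD : ∀ a, ∂ t a = 0 → ∃ b, ∂ t b = 0 ∧ ⁅D, a • ∂ t⁆ = b • ∂ t ∧ ⁅E, a • ∂ t⁆ = b • ∂ t) :
    g D - E ∈ constIdeal k p t := by
  refine mem_constIdeal_of_lie_eq_zero fun a ha => ?_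
  obtain ⟨b, hb, h1, h2⟩ := hD a ha
  have h3 := LieEquiv.map_lie g D (a • ∂ t)
  rw [h1, hJ b hb, hJ a ha] at h3
  rw [sub_lie, ← h3, h2, sub_self]

/-- Commuting with `∂_t` frees the coefficients of `Z` from `x_t`, so `X ∂_t` acts with weight `0`
on the components along `∂_r`, `r ≠ t`, and with weight `-1` along `∂_t`. Any other weight forces `Z
= 0`. -/
theorem weight_apply_gen {Z : Witt k p n} {X : TruncPoly k p n} {μ : k} {c : k}
    (hX : X = 𝐱 t + algebraMap k (TruncPoly k p n) c) (h1 : ⁅∂ t, Z⁆ = 0) (h2 : ⁅X • ∂ t, Z⁆ = μ • Z) :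
    (∀ r, r ≠ t → μ • Z (𝐱 r) = 0) ∧ (μ + 1) • Z (𝐱 t) = 0 := by
  have h3 : ∀ r, ∂ t (Z (𝐱 r)) = 0 := fun r => by
    have h := Derivation.congr_fun h1 (𝐱 r)
    rw [Derivation.commutator_apply, del_gen, Derivation.zero_apply] at h
    split_ifs at h <;> simpa using h
  refine ⟨fun r hr => ?_, ?_⟩
  · have h := Derivation.congr_fun h2 (𝐱 r)
    rw [Derivation.commutator_apply, smul_del_apply_gen, if_neg hr.symm] at h
    simpa [h3] using h.symm
  · have h := Derivation.congr_fun h2 (𝐱 t)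
    rw [Derivation.commutator_apply, smul_del_apply_gen, if_pos rfl, hX] at h
    rw [Derivation.smul_apply, h3, map_add, Derivation.map_algebraMap, add_zero, smul_zero,
      zero_sub] at h
    rw [add_smul, one_smul]
    change _ = μ • Z (𝐱 t) at h
    rw [← h, neg_add_cancel]

theorem weight_sub_apply_gen (hd : g (∂ t) = ∂ t)
    (hx : g (𝐱 t • ∂ t) = (𝐱 t + algebraMap k (TruncPoly k p n) c) • ∂ t) {E E' F F' : Witt k p n} {μ ν : k}
    (hF : g F = F') (h1 : ⁅∂ t, E⁆ = ν • F) (h2 : ⁅∂ t, E'⁆ = ν • F')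
    (h3 : ⁅𝐱 t • ∂ t, E⁆ = μ • E) (h4 : ⁅(𝐱 t + algebraMap k (TruncPoly k p n) c) • ∂ t, E'⁆ = μ • E') :
    (∀ r, r ≠ t → μ • (g E - E') (𝐱 r) = 0) ∧ (μ + 1) • (g E - E') (𝐱 t) = 0 := by
  have hsmul : ∀ (a : k) (D : Witt k p n), g (a • D) = a • g D := fun a D =>
    map_smul g.toLinearEquiv a D
  refine weight_apply_gen (c := c) rfl ?_ ?_
  · have h := LieEquiv.map_lie g (∂ t) E
    rw [hd, h1, hsmul, hF] at h
    rw [lie_sub, h2, ← h, sub_self]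
  · have h := LieEquiv.map_lie g (𝐱 t • ∂ t) E
    rw [hx, h3, hsmul] at h
    rw [lie_sub, h4, ← h, smul_sub]

section Fixed

theorem del_gen_add_algebraMap (t : Fin n) (c : k) : ∂ t (𝐱 t + algebraMap k (TruncPoly k p n) c) = 1 := by
  rw [map_add, Derivation.map_algebraMap, del_gen, if_pos rfl, add_zero]

theorem del_gen_add_algebraMap_ne {q : Fin n} (hq : q ≠ t) (c : k) :
    ∂ q (𝐱 t + algebraMap k (TruncPoly k p n) c) = 0 := by
  rw [map_add, Derivation.map_algebraMap, del_gen, if_neg hq, add_zero]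

theorem apply_smul_del
    (hJ : ∀ a : TruncPoly k p n, ∂ t a = 0 → g (a • ∂ t) = a • ∂ t)
    (hx : g (𝐱 t • ∂ t) = (𝐱 t + algebraMap k (TruncPoly k p n) c) • ∂ t)
    {a : TruncPoly k p n} (ha : ∂ t a = 0) {q : Fin n} (hq : q ≠ t) :
    g (a • ∂ q) = a • ∂ q := by
  have h1 : g (a • ∂ q) - a • ∂ q ∈ constIdeal k p t := by
    refine apply_mem_constIdeal_sub hJ fun f hf => ?_
    have h : ⁅a • ∂ q, f • ∂ t⁆ = (a * ∂ q f) • ∂ t := by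
      rw [lie_smul_del, ha, mul_zero, zero_smul, sub_zero]
    exact ⟨_, by simp [ha, del_comm t q, hf], h, h⟩
  have h2 : ∀ c : k, ⁅a • ∂ q, (𝐱 t + algebraMap k (TruncPoly k p n) c) • ∂ t⁆ = 0 := fun c => by
    rw [lie_smul_del, ha, del_gen_add_algebraMap_ne hq, mul_zero, mul_zero, zero_smul, zero_smul,
      sub_zero]
  have h3 := LieEquiv.map_lie g (a • ∂ q) (𝐱 t • ∂ t)
  have h20 := h2 0
  rw [map_zero, add_zero] at h20
  rw [h20, hx, map_zero] at h3
  -- On `constIdeal`, bracketing with `(x_t + c) ∂_t` is the identity, so a difference lying there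
  -- and killed by this bracket is zero.
  have h4 : ⁅g (a • ∂ q) - a • ∂ q, (𝐱 t + algebraMap k (TruncPoly k p n) c) • ∂ t⁆ = 0 := by
    rw [sub_lie, ← h3, h2, sub_zero]
  rw [eq_smul_del h1.1, lie_smul_del, h1.2, del_gen_add_algebraMap, mul_zero, zero_smul, sub_zero,
    mul_one, ← eq_smul_del h1.1] at h4
  exact sub_eq_zero.1 h4

theorem sub_apply_gen_of_pow_succ
    (hJ : ∀ a : TruncPoly k p n, ∂ t a = 0 → g (a • ∂ t) = a • ∂ t)
    (hx : g (𝐱 t • ∂ t) = (𝐱 t + algebraMap k (TruncPoly k p n) c) • ∂ t)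
    {a : TruncPoly k p n} (ha : ∂ t a = 0) {q : Fin n} (hq : q ≠ t)
    {m : ℕ} (hm : g ((𝐱 t ^ m * a) • ∂ q) = ((𝐱 t + algebraMap k (TruncPoly k p n) c) ^ m * a) • ∂ q) :
    (∀ r, r ≠ t → ((m + 1 : ℕ) : k) • (g ((𝐱 t ^ (m + 1) * a) • ∂ q) -
      ((𝐱 t + algebraMap k (TruncPoly k p n) c) ^ (m + 1) * a) • ∂ q) (𝐱 r) = 0) ∧
    (((m + 1 : ℕ) : k) + 1) • (g ((𝐱 t ^ (m + 1) * a) • ∂ q) -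
      ((𝐱 t + algebraMap k (TruncPoly k p n) c) ^ (m + 1) * a) • ∂ q) (𝐱 t) = 0 := by
  have hd : g (∂ t) = ∂ t := by simpa using hJ 1 (Derivation.map_one_eq_zero _)
  have h1 : ∀ c : k, ⁅∂ t, ((𝐱 t + algebraMap k (TruncPoly k p n) c) ^ (m + 1) * a) • ∂ q⁆ =
      ((m + 1 : ℕ) : k) • ((𝐱 t + algebraMap k (TruncPoly k p n) c) ^ m * a) • ∂ q := fun c => by
    rw [lie_del_smul_del, del_pow_mul (del_gen_add_algebraMap t c) ha, smul_assoc]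
  have h2 : ∀ c : k, ⁅(𝐱 t + algebraMap k (TruncPoly k p n) c) • ∂ t,
      ((𝐱 t + algebraMap k (TruncPoly k p n) c) ^ (m + 1) * a) • ∂ q⁆ =
      ((m + 1 : ℕ) : k) • ((𝐱 t + algebraMap k (TruncPoly k p n) c) ^ (m + 1) * a) • ∂ q := fun c => by
    rw [lie_smul_del, del_pow_mul (del_gen_add_algebraMap t c) ha, del_gen_add_algebraMap_ne hq,
      mul_zero, zero_smul, sub_zero, mul_smul_comm, ← mul_assoc, ← pow_succ', smul_assoc]
  have h10 := h1 0
  have h20 := h2 0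
  rw [map_zero, add_zero] at h10 h20
  exact weight_sub_apply_gen hd hx hm h10 (h1 c) h20 (h2 c)

variable [Fact p.Prime]

/-- The weight of `x_t^m a ∂_q` is `m`. The exponent `p - 1` is excluded because its weight is `-1`,
which leaves the component along `∂_t` undetermined. -/
theorem apply_pow_smul_del
    (hJ : ∀ a : TruncPoly k p n, ∂ t a = 0 → g (a • ∂ t) = a • ∂ t)
    (hx : g (𝐱 t • ∂ t) = (𝐱 t + algebraMap k (TruncPoly k p n) c) • ∂ t)
    {a : TruncPoly k p n} (ha : ∂ t a = 0) {q : Fin n} (hq : q ≠ t)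
    {m : ℕ} (hm : m + 1 < p) :
    g ((𝐱 t ^ m * a) • ∂ q) = ((𝐱 t + algebraMap k (TruncPoly k p n) c) ^ m * a) • ∂ q := by
  induction m with
  | zero => simpa using apply_smul_del hJ hx ha hq
  | succ m ih =>
    obtain ⟨h1, h2⟩ := sub_apply_gen_of_pow_succ hJ hx ha hq (ih (by omega))
    have hm1 : ((m + 1 : ℕ) : k) ≠ 0 := natCast_ne_zero_of_lt (p := p) (by omega) (by omega)
    have hm2 : ((m + 1 : ℕ) : k) + 1 ≠ 0 := by
      exact_mod_cast natCast_ne_zero_of_lt (k := k) (p := p) (a := m + 1 + 1) (by omega) hm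
    refine sub_eq_zero.1 (witt_ext_gen fun r => ?_)
    rw [Derivation.zero_apply]
    by_cases hr : r = t
    · subst hr
      exact (smul_eq_zero_iff_right hm2).1 h2
    · exact (smul_eq_zero_iff_right hm1).1 (h1 r hr)

theorem apply_pow_smul_del_self
    (hJ : ∀ a : TruncPoly k p n, ∂ t a = 0 → g (a • ∂ t) = a • ∂ t)
    (hx : g (𝐱 t • ∂ t) = (𝐱 t + algebraMap k (TruncPoly k p n) c) • ∂ t)
    {a : TruncPoly k p n} (ha : ∂ t a = 0) {m : ℕ} (hm : m < p) :
    g ((𝐱 t ^ m * a) • ∂ t) = ((𝐱 t + algebraMap k (TruncPoly k p n) c) ^ m * a) • ∂ t := by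
  have hd : g (∂ t) = ∂ t := by simpa using hJ 1 (Derivation.map_one_eq_zero _)
  induction m with
  | zero => simpa using hJ a ha
  | succ m ih =>
    have h1 : ∀ c : k, ⁅∂ t, ((𝐱 t + algebraMap k (TruncPoly k p n) c) ^ (m + 1) * a) • ∂ t⁆ =
        ((m + 1 : ℕ) : k) • ((𝐱 t + algebraMap k (TruncPoly k p n) c) ^ m * a) • ∂ t := fun c => by
      rw [lie_del_smul_del, del_pow_mul (del_gen_add_algebraMap t c) ha, smul_assoc]
    have h2 : ∀ c : k, ⁅(𝐱 t + algebraMap k (TruncPoly k p n) c) • ∂ t,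
        ((𝐱 t + algebraMap k (TruncPoly k p n) c) ^ (m + 1) * a) • ∂ t⁆ =
        (m : k) • ((𝐱 t + algebraMap k (TruncPoly k p n) c) ^ (m + 1) * a) • ∂ t := fun c => by
      rw [lie_smul_del, del_pow_mul (del_gen_add_algebraMap t c) ha, del_gen_add_algebraMap,
        mul_one, mul_smul_comm, ← mul_assoc, ← pow_succ', smul_assoc, Nat.cast_succ, add_smul,
        one_smul, add_sub_cancel_right]
    have h10 := h1 0
    have h20 := h2 0
    rw [map_zero, add_zero] at h10 h20
    obtain ⟨h3, h4⟩ := weight_sub_apply_gen hd hx (ih (by omega)) h10 (h1 c) h20 (h2 c)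
    have hm2 : (m : k) + 1 ≠ 0 := by
      exact_mod_cast natCast_ne_zero_of_lt (k := k) (p := p) (a := m + 1) (by omega) hm
    refine sub_eq_zero.1 (witt_ext_gen fun r => ?_)
    rw [Derivation.zero_apply]
    by_cases hr : r = t
    · subst hr
      exact (smul_eq_zero_iff_right hm2).1 h4
    -- The weight of `x_t a ∂_t` is `0`, so weights say nothing about the components with `r ≠ t`;
    -- the action on `constIdeal` settles this case instead.
    · by_cases hm0 : m = 0
      · subst hm0
        have h5 : ∀ (f : TruncPoly k p n) (c : k), ∂ t f = 0 →
            ⁅((𝐱 t + algebraMap k (TruncPoly k p n) c) ^ (0 + 1) * a) • ∂ t, f • ∂ t⁆ = (-(f * a)) • ∂ t :=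
          fun f c hf => by
            rw [lie_smul_del, del_pow_mul (del_gen_add_algebraMap t c) ha, hf, mul_zero,
              zero_smul, zero_sub, neg_smul]
            simp
        refine (apply_mem_constIdeal_sub hJ fun f hf => ⟨-(f * a), by simp [hf, ha], ?_, ?_⟩).1 r hr
        · have := h5 f 0 hf
          rwa [map_zero, add_zero] at this
        · exact h5 f c hf
      · exact (smul_eq_zero_iff_right
          (natCast_ne_zero_of_lt (p := p) hm0 (by omega))).1 (h3 r hr)

theorem gen_add_algebraMap_pow (t : Fin n) (c : k) :
    (𝐱 t + algebraMap k (TruncPoly k p n) c) ^ p = algebraMap k (TruncPoly k p n) (c ^ p) := by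
  rw [pow_eq_aug, map_add, aug_gen, zero_add, AlgHom.commutes, Algebra.algebraMap_self_apply]

theorem translation_eq_zero_of_three_lt
    (hJ : ∀ a : TruncPoly k p n, ∂ t a = 0 → g (a • ∂ t) = a • ∂ t)
    (hx : g (𝐱 t • ∂ t) = (𝐱 t + algebraMap k (TruncPoly k p n) c) • ∂ t)
    (hp : 3 < p) : c = 0 := by
  -- With `X = x_t + c`, the bracket of `X² ∂_t` and `X^{p-1} ∂_t` is `(p - 3) X^p ∂_t = -3 c^p
  -- ∂_t`. It vanishes for `c = 0`, hence also after applying `g`; `p > 3` makes `3` invertible.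
  have h1 : ∀ c : k, ⁅((𝐱 t + algebraMap k (TruncPoly k p n) c) ^ 2 * 1) • ∂ t,
      ((𝐱 t + algebraMap k (TruncPoly k p n) c) ^ (p - 1) * 1) • ∂ t⁆ =
      (-3 * c ^ p) • ∂ t := fun c => by
    obtain ⟨m, hm⟩ : ∃ m, p = m + 2 := ⟨p - 2, by omega⟩
    have hX := del_gen_add_algebraMap  t c
    have hone : ∂ t (1 : TruncPoly k p n) = 0 := Derivation.map_one_eq_zero _
    have hpow : (𝐱 t + algebraMap k (TruncPoly k p n) c) ^ (m + 2) =
        algebraMap k (TruncPoly k p n) (c ^ p) := by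
      rw [← hm]
      exact gen_add_algebraMap_pow t c
    have hcast : ((m : ℕ) : TruncPoly k p n) = -2 := by
      have := charP_truncPoly (k := k) (p := p) (n := n)
      have h : ((m + 2 : ℕ) : TruncPoly k p n) = 0 := by
        rw [← hm]
        exact CharP.cast_eq_zero _ p
      push_cast at h
      linear_combination h
    have e1 := del_pow_mul hX hone 1
    have e2 := del_pow_mul hX hone m
    rw [show p - 1 = m + 1 by omega, lie_smul_del, e2, e1, ← sub_smul]
    have h3 : ∀ s : k, s • (∂ t : Witt k p n) =
        (algebraMap k (TruncPoly k p n) s) • ∂ t := fun s => by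
      rw [algebraMap_smul]
    rw [h3]
    congr 1
    rw [Algebra.smul_def, Algebra.smul_def, map_mul, ← hpow]
    push_cast
    rw [hcast]
    simp only [map_ofNat]
    ring
  have h10 := h1 0
  rw [map_zero, add_zero, zero_pow (by omega), mul_zero, zero_smul] at h10
  have h2 := LieEquiv.map_lie g ((𝐱 t ^ 2 * 1) • ∂ t) ((𝐱 t ^ (p - 1) * 1) • ∂ t)
  have hone : ∂ t (1 : TruncPoly k p n) = 0 := Derivation.map_one_eq_zero _
  rw [h10, apply_pow_smul_del_self hJ hx hone (by omega),
    apply_pow_smul_del_self hJ hx hone (by omega), h1, map_zero] at h2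
  have h3 := Derivation.congr_fun h2 (𝐱 t)
  rw [Derivation.zero_apply, Derivation.smul_apply, del_gen, if_pos rfl] at h3
  have h4 : -3 * c ^ p = 0 := by
    by_contra hne
    exact one_ne_zero ((smul_eq_zero_iff_right hne).1 h3.symm)
  have h5 : (3 : k) ≠ 0 := by
    exact_mod_cast natCast_ne_zero_of_lt (k := k) (p := p) (a := 3) (by omega) hp
  rcases mul_eq_zero.1 h4 with h | h
  · exact absurd (neg_eq_zero.1 h) h5
  · exact pow_eq_zero_iff (by omega) |>.1 h

theorem translation_eq_zero_of_ne
    (hJ : ∀ a : TruncPoly k p n, ∂ t a = 0 → g (a • ∂ t) = a • ∂ t)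
    (hx : g (𝐱 t • ∂ t) = (𝐱 t + algebraMap k (TruncPoly k p n) c) • ∂ t)
    (hp : 3 ≤ p) {q : Fin n} (hq : q ≠ t) : c = 0 := by
  have hone : ∂ t (1 : TruncPoly k p n) = 0 := Derivation.map_one_eq_zero _
  have hdq : ∂ t (𝐱 q) = 0 := by rw [del_gen, if_neg hq.symm]
  obtain ⟨m, hm⟩ : ∃ m, p = m + 2 := ⟨p - 2, by omega⟩
  obtain ⟨h1, -⟩ := sub_apply_gen_of_pow_succ hJ hx hone hq
    (apply_pow_smul_del hJ hx hone hq (m := m) (by omega))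
  have h2 := apply_pow_smul_del hJ hx hdq hq (m := 1) (by omega)
  -- Here `m + 1 = p - 1`, and the error `Z` has only a component along `∂_t`. Apply `g` to
  -- `[x_t^{p-1} ∂_q, x_t x_q ∂_q] = x_t^p ∂_q = 0` and take the constant term of the coefficient of
  -- `∂_q`: the contribution of `Z` carries a factor `x_q`, so `c^p = 0` remains.
  set Z := g ((𝐱 t ^ (m + 1) * 1) • ∂ q) -
    ((𝐱 t + algebraMap k (TruncPoly k p n) c) ^ (m + 1) * 1) • ∂ q with hZ
  have hm1 : ((m + 1 : ℕ) : k) ≠ 0 := natCast_ne_zero_of_lt (p := p) (by omega) (by omega)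
  have h3 : Z (𝐱 q) = 0 := (smul_eq_zero_iff_right hm1).1 (h1 q hq)
  have h4 := sub_eq_iff_eq_add.1 hZ.symm
  have h5 := LieEquiv.map_lie g ((𝐱 t ^ (m + 1) * 1) • ∂ q)
    ((𝐱 t ^ 1 * 𝐱 q) • ∂ q)
  have h6 : ⁅(𝐱 t ^ (m + 1) * 1) • ∂ q,
      (𝐱 t ^ 1 * 𝐱 q) • ∂ q⁆ = 0 := by
    have : 𝐱 t ^ (m + 1) * 𝐱 t = 0 := by
      rw [← pow_succ, show m + 1 + 1 = p from hm.symm, gen_pow]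
    rw [lie_smul_del]
    simp [del_gen, hq, this]
  rw [h6, h4, h2, map_zero] at h5
  have h7 := Derivation.congr_fun h5 (𝐱 q)
  clear_value Z
  have h9 := congrArg aug h7
  rw [Derivation.zero_apply, add_lie, lie_smul_del, Derivation.add_apply,
    Derivation.commutator_apply, Derivation.sub_apply, smul_del_apply_gen, smul_del_apply_gen,
    smul_del_apply_gen, if_pos rfl, if_pos rfl, if_pos rfl, Derivation.smul_apply, h3] at h9
  simp [del_gen, hq] at h9
  rw [h3, map_zero, mul_zero, zero_add, ← pow_succ] at h9
  exact (pow_eq_zero_iff (Nat.succ_ne_zero _)).1 h9.symm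

/-- An automorphism of `W(n)` that fixes all `a ∂_t` with `∂_t a = 0` and translates `x_t ∂_t`
by a multiple of `∂_t` is the identity. -/
theorem eq_one_of_fixes (hp : 3 ≤ p) (hpn : n = 1 → 3 < p)
    (hJ : ∀ a : TruncPoly k p n, ∂ t a = 0 → g (a • ∂ t) = a • ∂ t)
    (hx : g (𝐱 t • ∂ t) = (𝐱 t + algebraMap k (TruncPoly k p n) c) • ∂ t) : g = 1 := by
  have hc : c = 0 := by
    by_cases hq : ∃ q, q ≠ t
    · obtain ⟨q, hq⟩ := hq
      exact translation_eq_zero_of_ne hJ hx hp hq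
    · push Not at hq
      refine translation_eq_zero_of_three_lt hJ hx (hpn ?_)
      have := Fintype.card_eq_one_iff.2 ⟨t, hq⟩
      rwa [Fintype.card_fin] at this
  have hfix : ∀ m, m < p → ∀ a : TruncPoly k p n, ∂ t a = 0 → ∀ q,
      g ((𝐱 t ^ m * a) • ∂ q) = (𝐱 t ^ m * a) • ∂ q := by
    intro m hm a ha q
    by_cases hq : q = t
    · subst hq
      have := apply_pow_smul_del_self hJ hx ha hm
      rwa [hc, map_zero, add_zero] at this
    · by_cases hm1 : m + 1 < p
      · have := apply_pow_smul_del hJ hx ha hq hm1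
        rwa [hc, map_zero, add_zero] at this
      -- The exceptional exponent `m = p - 1` is reached as a bracket of two elements already known
      -- to be fixed.
      · have h1 : ⁅(𝐱 t ^ m * 1) • ∂ t, (𝐱 t ^ 1 * a) • ∂ q⁆ = (𝐱 t ^ m * a) • ∂ q := by
          rw [lie_smul_del]
          simp [del_gen, hq, ha]
        have h2 := apply_pow_smul_del_self hJ hx (Derivation.map_one_eq_zero (∂ t)) hm
        have h3 := apply_pow_smul_del hJ hx ha hq (m := 1) (by omega)
        rw [hc, map_zero, add_zero] at h2 h3
        rw [← h1, LieEquiv.map_lie, h2, h3]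
  let S : Submodule k (Witt k p n) :=
    LinearMap.eqLocus (g : Witt k p n →ₗ[k] Witt k p n) LinearMap.id
  have hS : ∀ (f : TruncPoly k p n) (q : Fin n), f • ∂ q ∈ S := fun f q => by
    let T : TruncPoly k p n →ₗ[k] Witt k p n :=
      (LinearMap.toSpanSingleton (TruncPoly k p n) (Witt k p n) (∂ q)).restrictScalars k
    have hf := mem_span_xpow_of_del (R := ∅) (f := f) (by simp)
    have hle : Submodule.span k {h | ∃ a : Fin n → ℕ, (∀ i, a i < p) ∧
        (∀ i ∈ (∅ : Set (Fin n)), a i = 0) ∧ h = xpow k p n a} ≤ S.comap T := by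
      refine Submodule.span_le.2 ?_
      rintro _ ⟨a, ha, -, rfl⟩
      change g (xpow k p n a • ∂ q) = xpow k p n a • ∂ q
      rw [xpow_eq_mul t a]
      exact hfix _ (ha t) _ (by rw [del_xpow]; simp) q
    exact hle hf
  ext D : 1
  change D ∈ S
  rw [witt_eq_sum D]
  exact Submodule.sum_mem _ fun q _ => hS _ q

end Fixed

/-- Every automorphism of `W(n)` stabilizing the full-varied Borel subalgebra is induced by an
automorphism of `A(n)`. -/
theorem exists_conj_eq_of_mem_Bgen [Fact p.Prime] (hp : 3 ≤ p) (hpn : n = 1 → 3 < p)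
    (hg : g ∈ Bgen k p n) : ∃ η, conj k p n η = g := by
  rcases n with _ | n
  · have : Subsingleton (Witt k p 0) := ⟨fun D E => witt_ext_gen fun i => i.elim0⟩
    exact ⟨1, by ext D : 1; exact Subsingleton.elim _ _⟩
  · obtain ⟨η, c, h1, h2⟩ := exists_conj_eq_on_affineIdeal (t := Fin.last n) Fin.le_last
      (by omega) hg
    refine ⟨η, ?_⟩
    have h3 : (conj k p (n + 1) η)⁻¹ * g = 1 := by
      refine eq_one_of_fixes (t := Fin.last n) (c := c) hp hpn (fun a ha => ?_) ?_
      · change (conj k p (n + 1) η).symm (g _) = _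
        rw [h1 a ha, LieEquiv.symm_apply_apply]
      · change (conj k p (n + 1) η).symm (g _) = _
        rw [h2, LieEquiv.symm_apply_apply]
    exact inv_mul_eq_one.1 h3

end Rigidity

/-! ### The filtration of `A(n)` by order at the origin -/

section Order

/-- The span of the monomials of degree at least `N`. -/
def order (k : Type*) [Field k] (p n N : ℕ) : Submodule k (TruncPoly k p n) :=
  Submodule.span k {g | ∃ a : Fin n → ℕ, N ≤ ∑ i, a i ∧ g = xpow k p n a}

theorem xpow_mem_order (a : Fin n → ℕ) : xpow k p n a ∈ order k p n (∑ i, a i) :=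
  Submodule.subset_span ⟨a, le_rfl, rfl⟩

theorem order_antitone : Antitone (order k p n) := fun _ _ h =>
  Submodule.span_mono fun _ ⟨a, ha, hf⟩ => ⟨a, h.trans ha, hf⟩

theorem mem_order_zero (f : TruncPoly k p n) : f ∈ order k p n 0 := by
  obtain ⟨F, rfl⟩ := toTrunc_surjective k p n f
  rw [eq_sum_xpow]
  exact Submodule.sum_mem _ fun d _ =>
    Submodule.smul_mem _ _ (order_antitone (Nat.zero_le _) (xpow_mem_order _))

theorem mul_mem_order {M N : ℕ} {f g : TruncPoly k p n} (hf : f ∈ order k p n M)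
    (hg : g ∈ order k p n N) : f * g ∈ order k p n (M + N) := by
  have h := Submodule.mul_mem_mul hf hg
  rw [order, order, Submodule.span_mul_span] at h
  refine Submodule.span_mono ?_ h
  rintro _ ⟨_, ⟨a, ha, rfl⟩, _, ⟨b, hb, rfl⟩, rfl⟩
  refine ⟨a + b, ?_, ?_⟩
  · simp only [Pi.add_apply, Finset.sum_add_distrib]
    exact add_le_add ha hb
  · simp only [xpow, Pi.add_apply, pow_add, Finset.prod_mul_distrib]

theorem gen_mem_order (i : Fin n) : 𝐱 i ∈ order k p n 1 := by
  have h := xpow_mem_order (k := k) (p := p) (Pi.single i 1)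
  rwa [Finset.sum_pi_single', if_pos (Finset.mem_univ i), xpow_eq_mul i, Pi.single_eq_same,
    pow_one, xpow_eq_one (a := Function.update (Pi.single i 1) i 0), mul_one] at h
  simp [Pi.single]

theorem xpow_induction {Q : ℕ → TruncPoly k p n → Prop} (one : Q 0 1)
    (mul : ∀ M N f g, Q M f → Q N g → Q (M + N) (f * g)) (gen : ∀ i, Q 1 (𝐱 i))
    (a : Fin n → ℕ) : Q (∑ i, a i) (xpow k p n a) := by
  have hpow : ∀ i m, Q m (𝐱 i ^ m) := fun i m => by
    induction m with
    | zero => rwa [pow_zero]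
    | succ m ih => rw [pow_succ]; exact mul _ _ _ _ ih (gen i)
  rw [xpow]
  induction (Finset.univ : Finset (Fin n)) using Finset.induction_on with
  | empty => simpa using one
  | insert i s hi ih =>
    rw [Finset.sum_insert hi, Finset.prod_insert hi]
    exact mul _ _ _ _ (hpow i _) ih

section Aug

variable [Fact p.Prime]

theorem aug_xpow {a : Fin n → ℕ} (h : ∑ i, a i ≠ 0) : aug (xpow k p n a) = 0 := by
  obtain ⟨i, -, hi⟩ := Finset.exists_ne_zero_of_sum_ne_zero h
  rw [xpow, map_prod]
  exact Finset.prod_eq_zero (Finset.mem_univ i) (by rw [map_pow, aug_gen, zero_pow hi])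

theorem mem_order_one_iff {f : TruncPoly k p n} : f ∈ order k p n 1 ↔ aug f = 0 := by
  constructor
  · intro hf
    have hle : order k p n 1 ≤ LinearMap.ker (aug (k := k) (p := p) (n := n)).toLinearMap := by
      refine Submodule.span_le.2 ?_
      rintro _ ⟨a, ha, rfl⟩
      exact aug_xpow (by omega)
    exact hle hf
  · intro hf
    have hle : order k p n 0 ≤ (order k p n 1).comap
        (LinearMap.id - Algebra.linearMap k (TruncPoly k p n) ∘ₗ aug.toLinearMap) := by
      refine Submodule.span_le.2 ?_
      rintro _ ⟨a, -, rfl⟩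
      change xpow k p n a - algebraMap k _ (aug (xpow k p n a)) ∈ order k p n 1
      by_cases ha : ∑ i, a i = 0
      · rw [xpow_eq_one ha, map_one, map_one, sub_self]
        exact zero_mem _
      · rw [aug_xpow ha, map_zero, sub_zero]
        exact order_antitone (Nat.one_le_iff_ne_zero.2 ha) (xpow_mem_order a)
    have h : f - algebraMap k _ (aug f) ∈ order k p n 1 := hle (mem_order_zero f)
    rwa [hf, map_zero, sub_zero] at h

variable [CharP k p]

/-- The images of the generators still have vanishing `p`-th power, so they have no constant term.
-/
theorem aug_autA (φ : AutA k p n) (f : TruncPoly k p n) : aug (φ f) = aug f := by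
  have : aug.comp (φ : TruncPoly k p n →ₐ[k] TruncPoly k p n) = aug := algHom_ext_gen fun i => by
    rw [aug_gen]
    change aug (φ (𝐱 i)) = 0
    rw [← pow_eq_zero_iff_aug, ← map_pow, gen_pow, map_zero]
  exact DFunLike.congr_fun this f

theorem autA_mem_order (φ : AutA k p n) {N : ℕ} {f : TruncPoly k p n} (hf : f ∈ order k p n N) :
    φ f ∈ order k p n N := by
  have hle : order k p n N ≤ (order k p n N).comap φ.toLinearMap := by
    refine Submodule.span_le.2 ?_
    rintro _ ⟨a, ha, rfl⟩
    refine order_antitone ha ?_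
    refine xpow_induction (Q := fun N f => φ f ∈ order k p n N) (mem_order_zero _) ?_ ?_ a
    · intro M N f g hf hg
      rw [map_mul]
      exact mul_mem_order hf hg
    · intro i
      rw [mem_order_one_iff, aug_autA, aug_gen]
  exact hle hf

theorem autA_sub_mem_order {φ : AutA k p n} (hφ : ∀ i, φ (𝐱 i) - 𝐱 i ∈ order k p n 2) {N : ℕ}
    {f : TruncPoly k p n} (hf : f ∈ order k p n N) : φ f - f ∈ order k p n (N + 1) := by
  have hle : order k p n N ≤ (order k p n (N + 1)).comap (φ.toLinearMap - LinearMap.id) := by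
    refine Submodule.span_le.2 ?_
    rintro _ ⟨a, ha, rfl⟩
    change φ (xpow k p n a) - xpow k p n a ∈ order k p n (N + 1)
    refine order_antitone (Nat.succ_le_succ ha) ?_
    refine (xpow_induction (Q := fun N f => f ∈ order k p n N ∧ φ f - f ∈ order k p n (N + 1))
      ⟨mem_order_zero _, ?_⟩ ?_ ?_ a).2
    · rw [map_one, sub_self]
      exact zero_mem _
    · rintro M N f g ⟨hf, hf'⟩ ⟨hg, hg'⟩
      refine ⟨mul_mem_order hf hg, ?_⟩
      -- In each summand one factor gains a degree, and `φ g` keeps the order of `g`.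
      have h : φ (f * g) - f * g = (φ f - f) * φ g + f * (φ g - g) := by
        rw [map_mul]; ring
      rw [h]
      refine add_mem ?_ (by simpa [add_assoc] using mul_mem_order hf hg')
      have := mul_mem_order hf' (autA_mem_order φ hg)
      rwa [add_right_comm] at this
    · exact fun i => ⟨gen_mem_order i, hφ i⟩
  exact hle hf

end Aug

variable [CharP k p]

theorem del_mem_order {N : ℕ} {f : TruncPoly k p n} (hf : f ∈ order k p n (N + 1)) (i : Fin n) :
    ∂ i f ∈ order k p n N := by
  have hle : order k p n (N + 1) ≤ (order k p n N).comap (∂ i).toLinearMap := by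
    refine Submodule.span_le.2 ?_
    rintro _ ⟨a, ha, rfl⟩
    change ∂ i (xpow k p n a) ∈ order k p n N
    rw [del_xpow]
    by_cases hai : a i = 0
    · rw [hai, Nat.cast_zero, zero_smul]
      exact zero_mem _
    · refine Submodule.smul_mem _ _ (order_antitone ?_ (xpow_mem_order _))
      rw [Finset.sum_update_of_mem (Finset.mem_univ i)]
      rw [← Finset.add_sum_erase _ _ (Finset.mem_univ i), ← Finset.sdiff_singleton_eq_erase] at ha
      omega
  exact hle hf

/-- First-order Taylor expansion at the origin: subtracting `T f`, the linear part of `f`, leaves an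
element of order at least 2. -/
theorem mem_order_two [Fact p.Prime] {f : TruncPoly k p n} (h0 : aug f = 0)
    (h1 : ∀ i, aug (∂ i f) = 0) : f ∈ order k p n 2 := by
  let T : TruncPoly k p n →ₗ[k] TruncPoly k p n := ∑ i : Fin n,
    (LinearMap.toSpanSingleton k (TruncPoly k p n) (𝐱 i)) ∘ₗ aug.toLinearMap ∘ₗ (∂ i).toLinearMap
  have hT : ∀ g, T g = ∑ i, aug (∂ i g) • 𝐱 i := fun g => by
    rw [LinearMap.sum_apply]
    rfl
  have hle : order k p n 1 ≤ (order k p n 2).comap (LinearMap.id - T) := by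
    refine Submodule.span_le.2 ?_
    rintro _ ⟨a, ha, rfl⟩
    change xpow k p n a - T (xpow k p n a) ∈ order k p n 2
    rw [hT]
    rcases Nat.eq_or_lt_of_le ha with ha | ha
    · obtain ⟨i, -, hi⟩ := exists_xpow_eq_gen (k := k) (p := p) ha.symm
      have : xpow k p n a - ∑ j, aug (∂ j (xpow k p n a)) • 𝐱 j = 0 := by
        rw [hi, sub_eq_zero]
        simp [del_gen, apply_ite aug]
      rw [this]
      exact zero_mem _
    · have h2 : xpow k p n a ∈ order k p n 2 := order_antitone ha (xpow_mem_order a)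
      rw [Finset.sum_eq_zero, sub_zero]
      · exact h2
      · intro i _
        rw [mem_order_one_iff.1 (del_mem_order h2 i), zero_smul]
  have h : f - T f ∈ order k p n 2 := hle (mem_order_one_iff.2 h0)
  rw [hT, Finset.sum_eq_zero, sub_zero] at h
  · exact h
  · intro i _
    rw [h1, zero_smul]

end Order

/-! ### The standard filtration of `W(n)` and the group `U` -/

section Filtration

variable [CharP k p]

/-- For `i ≤ -1` the truncation `toNat` gives order `0`, which is no condition, in agreement with
the filtration starting in degree `-1`. -/
theorem mem_filt_iff {i : ℤ} {D : Witt k p n} :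
    D ∈ filt k p n i ↔ ∀ q, D (𝐱 q) ∈ order k p n (i + 1).toNat := by
  constructor
  · intro hD q
    let ev : Witt k p n →ₗ[k] TruncPoly k p n :=
      { toFun := fun E => E (𝐱 q)
        map_add' := fun _ _ => rfl
        map_smul' := fun _ _ => rfl }
    have hle : filt k p n i ≤ (order k p n (i + 1).toNat).comap ev := by
      refine iSup₂_le fun j hj => Submodule.span_le.2 ?_
      rintro _ ⟨a, r, -, ha, rfl⟩
      change (xpow k p n a • ∂ r) (𝐱 q) ∈ order k p n (i + 1).toNat
      rw [smul_del_apply_gen]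
      split_ifs
      · exact order_antitone (by omega) (xpow_mem_order a)
      · exact zero_mem _
    exact hle hD
  · intro h
    rw [witt_eq_sum D]
    refine Submodule.sum_mem _ fun q _ => ?_
    let T : TruncPoly k p n →ₗ[k] Witt k p n :=
      (LinearMap.toSpanSingleton (TruncPoly k p n) (Witt k p n) (∂ q)).restrictScalars k
    have hle : order k p n (i + 1).toNat ≤ (filt k p n i).comap T := by
      refine Submodule.span_le.2 ?_
      rintro _ ⟨a, ha, rfl⟩
      change xpow k p n a • ∂ q ∈ filt k p n i
      by_cases hap : ∃ l, p ≤ a l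
      · obtain ⟨l, hl⟩ := hap
        rw [xpow_eq_zero hl, zero_smul]
        exact zero_mem _
      · push Not at hap
        have hmem : xpow k p n a • ∂ q ∈ grade k p n (((∑ l, a l : ℕ) : ℤ) - 1) :=
          Submodule.subset_span ⟨a, q, hap, by ring, rfl⟩
        exact (le_iSup₂_of_le (f := fun j (_ : i ≤ j) => grade k p n j)
          (((∑ l, a l : ℕ) : ℤ) - 1) (by omega) le_rfl) hmem
    exact hle (h q)

theorem apply_mem_order {i : ℤ} {D : Witt k p n} (hD : D ∈ filt k p n i) {N : ℕ}
    {f : TruncPoly k p n} (hf : f ∈ order k p n (N + 1)) :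
    D f ∈ order k p n ((i + 1).toNat + N) := by
  rw [witt_apply_eq_sum]
  exact Submodule.sum_mem _ fun q _ => mul_mem_order (mem_filt_iff.1 hD q) (del_mem_order hf q)

variable [Fact p.Prime]

theorem conj_mem_filt (φ : AutA k p n) {i : ℤ} {D : Witt k p n} (hD : D ∈ filt k p n i) :
    conj k p n φ D ∈ filt k p n i := mem_filt_iff.2 fun q => by
  rw [conj_apply]
  exact autA_mem_order φ (apply_mem_order hD (N := 0)
    (autA_mem_order φ.symm (gen_mem_order q)))

theorem mem_U_iff {g : AutW k p n} :
    g ∈ U k p n ↔ ∀ i : ℤ, ∀ D ∈ filt k p n i, g D - D ∈ filt k p n (i + 1) := Iff.rfl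

theorem conj_mem_U {φ : AutA k p n} (hφ : ∀ i, φ (𝐱 i) - 𝐱 i ∈ order k p n 2) :
    conj k p n φ ∈ U k p n := by
  refine mem_U_iff.2 fun i D hD => ?_
  refine mem_filt_iff.2 fun q => ?_
  have hw : φ.symm (𝐱 q) - 𝐱 q ∈ order k p n 2 := by
    have h := autA_mem_order φ.symm (neg_mem (hφ q))
    rwa [neg_sub, map_sub, φ.symm_apply_apply] at h
  -- The first term gains a degree because `φ⁻¹` moves `x_q` only in order 2, the second because `φ
  -- - id` raises order.
  have h : (conj k p n φ D - D) (𝐱 q) =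
      φ (D (φ.symm (𝐱 q) - 𝐱 q)) + (φ (D (𝐱 q)) - D (𝐱 q)) := by
    rw [Derivation.sub_apply, conj_apply, map_sub, map_sub]
    ring
  rw [h]
  have h1 := autA_mem_order φ (apply_mem_order hD hw)
  have h2 := autA_sub_mem_order hφ (mem_filt_iff.1 hD q)
  have hle : (i + 1 + 1).toNat ≤ (i + 1).toNat + 1 := by omega
  exact order_antitone hle (Submodule.add_mem _ h1 h2)

end Filtration

/-! ### Linear parts and the semidirect decomposition -/

section Semidirect

theorem upperLinear_le_triangular [Fact p.Prime] : upperLinear k p n ≤ triangular k p n := by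
  rintro φ ⟨M, -, hM, hφ⟩ j
  refine sub_mem ?_ (gen_mem_linPart k p n j)
  rw [hφ]
  refine Submodule.sum_mem _ fun i _ => ?_
  rcases lt_trichotomy i j with h | rfl | h
  · exact Submodule.smul_mem _ _ (subPoly_le_linPart k p n j (Algebra.subset_adjoin ⟨i, h, rfl⟩))
  · exact Submodule.smul_mem _ _ (gen_mem_linPart k p n i)
  · rw [hM i j h, zero_smul]
    exact zero_mem _

variable [Fact p.Prime] [CharP k p]

theorem eq_one_of_mem_upperLinear {φ : AutA k p n} (hφ : φ ∈ upperLinear k p n)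
    (hU : conj k p n φ ∈ U k p n) : φ = 1 := by
  obtain ⟨M, -, -, hM⟩ := hφ
  have hM1 : ∀ i j, M i j = if i = j then 1 else 0 := fun i j => by
    have h0 : ∂ i ∈ filt k p n (-1) := mem_filt_iff.2 fun q =>
      order_antitone (b := 0) (by simp) (mem_order_zero _)
    have h1 := mem_U_iff.1 hU (-1) (∂ i) h0
    rw [mem_filt_iff, show ((-1 : ℤ) + 1 + 1).toNat = 1 by norm_num] at h1
    have h2 : ∀ q, aug ((conj k p n φ (∂ i) - ∂ i) (𝐱 q)) = 0 := fun q =>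
      mem_order_one_iff.1 (h1 q)
    -- Membership in `U` removes the constant terms of `conj φ ∂_i - ∂_i`. At `φ(x_j)` the two
    -- derivations take the values `δ_ij` and `M i j`, so these agree.
    have h3 : aug ((conj k p n φ (∂ i) - ∂ i) (φ (𝐱 j))) = 0 := by
      rw [hM, map_sum, map_sum]
      refine Finset.sum_eq_zero fun l _ => ?_
      rw [Derivation.map_smul, map_smul, h2, smul_zero]
    rw [Derivation.sub_apply, conj_symm_apply, del_gen, hM, map_sum, map_sub, sub_eq_zero] at h3
    simp only [Derivation.map_smul, del_gen] at h3
    split_ifs with hij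
    · simpa [hij] using h3.symm
    · simpa [hij] using h3.symm
  exact autA_ext_gen fun j => by simp [hM, hM1]

/-- The chain rule at the origin, making Jacobian matrices multiplicative. -/
theorem aug_del_autA (φ : AutA k p n) (i : Fin n) (f : TruncPoly k p n) :
    aug (∂ i (φ f)) = ∑ l, aug (∂ i (φ (𝐱 l))) * aug (∂ l f) := by
  have h : ∀ f, aug (∂ i (φ f)) = aug (conj k p n φ⁻¹ (∂ i) f) := fun f =>
    (aug_autA φ⁻¹ _).symm
  rw [h, witt_apply_eq_sum, map_sum]
  exact Finset.sum_congr rfl fun l _ => by rw [map_mul, h]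

theorem exists_mem_upperLinear {φ : AutA k p n} (hφ : φ ∈ triangular k p n) :
    ∃ β ∈ upperLinear k p n, ∀ j, φ (𝐱 j) - β (𝐱 j) ∈ order k p n 2 := by
  -- `M` and `N` are the Jacobians at the origin of `φ` and its inverse. `M` is upper triangular
  -- because `∂_i` kills `linPart j` for `i > j`.
  let M : Matrix (Fin n) (Fin n) k := fun i j => aug (∂ i (φ (𝐱 j)))
  let N : Matrix (Fin n) (Fin n) k := fun i j => aug (∂ i (φ.symm (𝐱 j)))
  have hMN : M * N = 1 := by
    ext i j
    have h := aug_del_autA φ i (φ.symm (𝐱 j))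
    rw [φ.apply_symm_apply, del_gen] at h
    rw [Matrix.mul_apply, Matrix.one_apply]
    refine h.symm.trans ?_
    split_ifs <;> simp
  have hy : ∀ j, (∑ i, M i j • 𝐱 i) ^ p = 0 := fun j => by
    rw [pow_eq_zero_iff_aug, map_sum]
    exact Finset.sum_eq_zero fun i _ => by rw [map_smul, aug_gen, smul_zero]
  let β₀ : TruncPoly k p n →ₐ[k] TruncPoly k p n := liftHom (fun j => ∑ i, M i j • 𝐱 i) hy
  have hβ₀ : ∀ j, β₀ (𝐱 j) = ∑ i, M i j • 𝐱 i := fun j => liftHom_gen _ hy j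
  have hbij : Function.Bijective β₀ := bijective_of_gen_mem_range fun j => by
    refine ⟨∑ l, N l j • 𝐱 l, ?_⟩
    change β₀ _ = _
    simp only [map_sum, map_smul, hβ₀, Finset.smul_sum, smul_smul]
    rw [Finset.sum_comm]
    have h : ∀ i, ∑ l, N l j * M i l = (1 : Matrix (Fin n) (Fin n) k) i j := fun i => by
      rw [← hMN, Matrix.mul_apply]
      exact Finset.sum_congr rfl fun l _ => mul_comm _ _
    simp [← Finset.sum_smul, h, Matrix.one_apply]
  refine ⟨AlgEquiv.ofBijective β₀ hbij, ⟨M, ?_, fun i j hij => ?_, hβ₀⟩, fun j => ?_⟩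
  · exact (Matrix.isUnit_iff_isUnit_det M).2 (Matrix.isUnit_det_of_right_inverse hMN)
  · change aug (∂ i (φ (𝐱 j))) = 0
    rw [(mem_linPart_iff.1 (triangular_apply_mem_linPart hφ j)).1 i hij, map_zero]
  · change φ (𝐱 j) - β₀ (𝐱 j) ∈ _
    rw [hβ₀]
    refine mem_order_two ?_ fun i => ?_
    · rw [map_sub, aug_autA, aug_gen, map_sum, zero_sub, neg_eq_zero]
      exact Finset.sum_eq_zero fun i _ => by rw [map_smul, aug_gen, smul_zero]
    · rw [map_sub, map_sub, sub_eq_zero, map_sum, map_sum]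
      simp [del_gen, apply_ite aug, M]

theorem Bgen_eq_map_triangular (hp : 3 ≤ p) (hpn : n = 1 → 3 < p) :
    Bgen k p n = (triangular k p n).map (conj k p n) := by
  ext g
  constructor
  · intro hg
    obtain ⟨φ, rfl⟩ := exists_conj_eq_of_mem_Bgen hp hpn hg
    exact ⟨φ, mem_triangular_of_conj_mem_Bgen hg, rfl⟩
  · rintro ⟨φ, hφ, rfl⟩
    exact conj_mem_Bgen hφ

/-- Every induced automorphism preserves each filtration step, so conjugation by it preserves the
condition defining `U`. -/
theorem conj_mul_mul_inv_mem_U (φ : AutA k p n) {u : AutW k p n} (hu : u ∈ U k p n) :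
    conj k p n φ * u * (conj k p n φ)⁻¹ ∈ U k p n := by
  refine mem_U_iff.2 fun i D hD => ?_
  rw [← map_inv]
  have h := conj_mem_filt φ (mem_U_iff.1 hu i _ (conj_mem_filt φ⁻¹ hD))
  have h2 : conj k p n φ (u (conj k p n φ⁻¹ D) - conj k p n φ⁻¹ D) =
      (conj k p n φ * u * conj k p n φ⁻¹) D - D := by
    rw [map_sub, map_inv]
    congr 1
    exact (conj k p n φ).apply_symm_apply D
  rwa [h2] at h

theorem isInternalSemidirect_Bgen (hp : 3 ≤ p) (hpn : n = 1 → 3 < p) :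
    IsInternalSemidirect (Bgen k p n) (B0 k p n) (Un k p n) := by
  have hB := Bgen_eq_map_triangular (k := k) hp hpn
  have hB0 : B0 k p n ≤ Bgen k p n := hB ▸ Subgroup.map_mono upperLinear_le_triangular
  have hUn : Un k p n ≤ Bgen k p n := hB ▸ inf_le_right
  refine ⟨hB0, hUn, ⟨?_⟩, ?_⟩
  · rintro ⟨u, _⟩ hu ⟨g, hg⟩
    rw [Subgroup.mem_subgroupOf] at hu ⊢
    rw [hB] at hg
    obtain ⟨φ, hφ, rfl⟩ := hg
    have hφ' : conj k p n φ ∈ (triangular k p n).map (conj k p n) := ⟨φ, hφ, rfl⟩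
    exact Subgroup.mem_inf.2 ⟨conj_mul_mul_inv_mem_U φ (Subgroup.mem_inf.1 hu).1,
      mul_mem (mul_mem hφ' (Subgroup.mem_inf.1 hu).2) (inv_mem hφ')⟩
  · refine Subgroup.isComplement'_of_disjoint_and_mul_eq_univ ?_ ?_
    · rw [Subgroup.disjoint_def]
      rintro ⟨g, _⟩ hg hu
      rw [Subgroup.mem_subgroupOf] at hg hu
      obtain ⟨φ, hφ, rfl⟩ := hg
      have := eq_one_of_mem_upperLinear hφ hu.1
      subst this
      exact Subtype.ext (map_one _)
    · refine Set.eq_univ_of_forall ?_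
      rintro ⟨g, hg⟩
      have hg' := hg
      rw [hB] at hg'
      obtain ⟨φ, hφ, rfl⟩ := hg'
      obtain ⟨β, hβ, hφβ⟩ := exists_mem_upperLinear hφ
      have hβB : conj k p n β ∈ Bgen k p n := hB0 ⟨β, hβ, rfl⟩
      -- Since `φ` and its linear part `β` agree on generators modulo order 2, and `β⁻¹` preserves
      -- order, `β⁻¹ φ` is the identity on generators modulo order 2.
      have hτ : conj k p n (β⁻¹ * φ) ∈ Un k p n := by
        refine ⟨conj_mem_U fun i => ?_, ⟨_, mul_mem (inv_mem (upperLinear_le_triangular hβ)) hφ,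
          rfl⟩⟩
        have h := autA_mem_order β.symm (hφβ i)
        rw [map_sub, β.symm_apply_apply] at h
        exact h
      refine Set.mem_mul.2 ⟨⟨conj k p n β, hβB⟩, ?_, ⟨conj k p n (β⁻¹ * φ), hUn hτ⟩, ?_, ?_⟩
      · exact ⟨β, hβ, rfl⟩
      · exact hτ
      · refine Subtype.ext ?_
        change conj k p n β * conj k p n (β⁻¹ * φ) = conj k p n φ
        rw [← map_mul, mul_inv_cancel_left]

end Semidirect

end JacobsonWitt

end

theorem mainTheorem9 (k : Type*) [Field k] [IsAlgClosed k] (p n : ℕ) [Fact p.Prime] [CharP k p]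
    (hp : 3 ≤ p) (hpn : n = 1 → 3 < p) :
    Function.Injective (JacobsonWitt.conj k p n) ∧
    JacobsonWitt.Bgen k p n ≤
      (JacobsonWitt.flagIsotropy k p n).map (JacobsonWitt.conj k p n) ∧
    IsInternalSemidirect (JacobsonWitt.Bgen k p n) (JacobsonWitt.B0 k p n)
      (JacobsonWitt.Un k p n) := by
  refine ⟨JacobsonWitt.conj_injective, ?_, JacobsonWitt.isInternalSemidirect_Bgen hp hpn⟩
  rw [JacobsonWitt.Bgen_eq_map_triangular hp hpn]
  exact Subgroup.map_mono JacobsonWitt.triangular_le_flagIsotropy
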